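/- Let $D,n\in\mathbb N$, let $\Omega\subset\mathbb R^D$ be a Borel set (with Lebesgue measure), and let $L$ be a non-negative, self-adjoint operator on $L^2(\Omega,\mathbb C^n)$. Let $1\le p\le 2\le q\le\infty$ and $m\ge 2$ be such that $\frac Dm\bigl(\frac1p-\frac1q\bigr)<1$. For a bounded operator $T$ on $L^2(\Omega,\mathbb C^n)$ and $x,y\in\Omega$, $r>0$ put $$\bigl\|\mathbf 1_{B(x,r)}T\mathbf 1_{B(y,r)}\bigr\|_{p\to q}:=\sup\bigl\{\|\mathbf 1_{B(x,r)}T(\mathbf 1_{B(y,r)}f)\|_{L^q(\Omega,\mathbb C^n)}:\ f\in L^p\cap L^2(\Omega,\mathbb C^n),\ \|f\|_{L^p(\Omega,\mathbb C^n)}\le 1\bigr\}\in[0,\infty],$$ where $\mathbf 1_{B(x,r)}$ denotes multiplication by the characteristic function of the open ball $B(x,r)$. (a) Let $\theta\in(0,\pi/2)$ and suppose that there are constants $b,C>0$ such that for all $x,y\in\Omega$ and all $\lambda\in\mathbb C\setminus\{0\}$ with $|\arg\lambda|<\pi-\theta$ $$\bigl\|\mathbf 1_{B(x,|\lambda|^{-1/m})}\,\lambda(\lambda+L)^{-1}\,\mathbf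 1_{B(y,|\lambda|^{-1/m})}\bigr\|_{p\to q}\le C\,|\lambda|^{\frac Dm(\frac1p-\frac1q)}\,e^{-b|\lambda|^{1/m}|x-y|}.$$ Then there are constants $b',C'>0$ such that for all $t>0$ and all $x,y\in\Omega$ $$\bigl\|\mathbf 1_{B(x,t^{1/m})}\,e^{-tL}\,\mathbf 1_{B(y,t^{1/m})}\bigr\|_{p\to q}\le C'\,t^{-\frac Dm(\frac1p-\frac1q)}\exp\Bigl(-b'\Bigl(\frac{|x-y|}{t^{1/m}}\Bigr)^{\frac m{m-1}}\Bigr).$$ (b) Conversely, suppose that there are constants $b,C>0$ such that for all $t>0$ and all $x,y\in\Omega$ $$\bigl\|\mathbf 1_{B(x,t^{1/m})}\,e^{-tL}\,\mathbf 1_{B(y,t^{1/m})}\bigr\|_{p\to q}\le C\,t^{-\frac Dm(\frac1p-\frac1q)}\exp\Bigl(-b\Bigl(\frac{|x-y|}{t^{1/m}}\Bigr)^{\frac m{m-1}}\Bigr).$$ Then for every $\theta\in(0,\pi/2)$ there are constants $b',C'>0$ such that for all $x,y\in\Omega$ and all $\lambda\in\mathbb C\setminus\{0\}$ with $|\arg\lambda|<\theta$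 $$\bigl\|\mathbf 1_{B(x,|\lambda|^{-1/m})}\,\lambda(\lambda+L)^{-1}\,\mathbf 1_{B(y,|\lambda|^{-1/m})}\bigr\|_{p\to q}\le C'\,|\lambda|^{\frac Dm(\frac1p-\frac1q)}\,e^{-b'|\lambda|^{1/m}|x-y|}.$$ -/

import Mathlib

open MeasureTheory Set Filter Topology
open scoped ENNReal InnerProductSpace

noncomputable section

namespace TwoBall

section Abstract

variable {H : Type*} [NormedAddCommGroup H] [InnerProductSpace ℂ H]

/-- `L` is non-negative: `⟨L u, u⟩ ≥ 0` on the domain of `L`. -/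
def NonNegative (L : H →ₗ.[ℂ] H) : Prop :=
  ∀ u : L.domain, 0 ≤ (inner ℂ (L u) (u : H)).re

/-- `R` is a bounded, everywhere defined, two-sided inverse of `z + L : dom L → H`. -/
def IsShiftInverse (L : H →ₗ.[ℂ] H) (z : ℂ) (R : H →L[ℂ] H) : Prop :=
  (∀ u : L.domain, R (z • (u : H) + L u) = u) ∧
    ∀ f : H, ∃ h : R f ∈ L.domain, z • R f + L ⟨R f, h⟩ = f

open Classical in
/-- The resolvent operator `(z + L)⁻¹`; the value is `0` if `z + L` has no bounded inverse. -/
def shiftInv (L : H →ₗ.[ℂ] H) (z : ℂ) : H →L[ℂ] H :=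
  if h : ∃ R : H →L[ℂ] H, IsShiftInverse L z R then h.choose else 0

/-- The function `s ↦ exp (-t (1/s - 1))` on `(0, 1]`, extended by `0` to `s ≤ 0`; for `l ≥ 0` it
sends `1 / (1 + l)` to `exp (-t l)`. -/
def expSymbol (t s : ℝ) : ℝ := if 0 < s then Real.exp (-(t * (s⁻¹ - 1))) else 0

/-- The operator `e^{-tL}` (`t > 0`) of a non-negative self-adjoint operator `L`, by the functional
calculus: `l ↦ exp (-t l)` is applied to `L` by applying `expSymbol t` to `(1 + L)⁻¹`. -/
def semigroup [CompleteSpace H] (L : H →ₗ.[ℂ] H) (t : ℝ) : H →L[ℂ] H :=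
  cfc (expSymbol t) (shiftInv L 1)

theorem isShiftInverse_shiftInv {L : H →ₗ.[ℂ] H} {z : ℂ}
    (h : ∃ R : H →L[ℂ] H, IsShiftInverse L z R) : IsShiftInverse L z (shiftInv L z) := by
  unfold shiftInv
  rw [dif_pos h]
  exact h.choose_spec

variable [CompleteSpace H]

theorem inner_symm {L : H →ₗ.[ℂ] H} (hL : IsSelfAdjoint L) (u v : L.domain) :
    inner ℂ (L u) (v : H) = inner ℂ (u : H) (L v) := by
  have h := LinearPMap.adjoint_isFormalAdjoint hL.dense_domain
  have h2 : L.adjoint = L := hL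
  rw [h2] at h
  exact h u v

theorem inner_self_im {L : H →ₗ.[ℂ] H} (hL : IsSelfAdjoint L) (u : L.domain) :
    (inner ℂ (L u) (u : H)).im = 0 := by
  have h := inner_symm hL u u
  rw [← inner_conj_symm (u : H) (L u)] at h
  exact Complex.conj_eq_iff_im.1 h.symm

/-- Coercivity of `z + L` for `z` off the half-line `(-∞, 0]`. -/
theorem exists_coercive {L : H →ₗ.[ℂ] H} (hL : IsSelfAdjoint L) (h0 : NonNegative L)
    {z : ℂ} (hz : z ∈ Complex.slitPlane) :
    ∃ c : ℝ, 0 < c ∧ ∀ u : L.domain, c * ‖(u : H)‖ ≤ ‖z • (u : H) + L u‖ := by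
  have key : ∀ u : L.domain, ∀ c : ℝ,
      c * ‖(u : H)‖ ^ 2 ≤ ‖inner ℂ (u : H) (z • (u : H) + L u)‖ →
      c * ‖(u : H)‖ ≤ ‖z • (u : H) + L u‖ := by
    intro u c h
    have h1 := norm_inner_le_norm (𝕜 := ℂ) (u : H) (z • (u : H) + L u)
    rcases (norm_nonneg (u : H)).eq_or_lt with h2 | h2
    · rw [← h2]; simp
    · have : ‖(u : H)‖ * (c * ‖(u : H)‖) ≤ ‖(u : H)‖ * ‖z • (u : H) + L u‖ := by nlinarith
      exact le_of_mul_le_mul_left this h2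
  have comp : ∀ u : L.domain, inner ℂ (u : H) (z • (u : H) + L u) =
      z * ((‖(u : H)‖ ^ 2 : ℝ) : ℂ) + ((inner ℂ (L u) (u : H)).re : ℂ) := by
    intro u
    rw [inner_add_right, inner_smul_right, inner_self_eq_norm_sq_to_K, ← inner_symm hL]
    congr 1
    · simp
    · apply Complex.ext
      · simp
      · simp [inner_self_im hL]
  rcases hz with hz | hz
  · refine ⟨z.re, hz, fun u => key u _ ?_⟩
    refine le_trans ?_ (Complex.re_le_norm _)
    rw [comp, Complex.add_re, Complex.re_mul_ofReal, Complex.ofReal_re]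
    have := h0 u
    linarith
  · refine ⟨|z.im|, abs_pos.2 hz, fun u => key u _ ?_⟩
    refine le_trans ?_ (Complex.abs_im_le_norm _)
    rw [comp, Complex.add_im, Complex.im_mul_ofReal, Complex.ofReal_im, add_zero, abs_mul,
      abs_of_nonneg (sq_nonneg ‖(u : H)‖)]

/-- For `z` off `(-∞, 0]` the inverse of `z + L` exists, so `shiftInv` is a genuine inverse. -/
theorem isShiftInverse_of_mem_slitPlane {L : H →ₗ.[ℂ] H} (hL : IsSelfAdjoint L)
    (h0 : NonNegative L) {z : ℂ} (hz : z ∈ Complex.slitPlane) :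
    IsShiftInverse L z (shiftInv L z) := by
  apply isShiftInverse_shiftInv
  obtain ⟨c, hc, hcoer⟩ := exists_coercive hL h0 hz
  obtain ⟨c', hc', hcoer'⟩ := exists_coercive hL h0 (z := starRingEnd ℂ z)
    (by rcases hz with h | h
        · left; simpa using h
        · right; simpa using h)
  let M : L.domain →ₗ[ℂ] H := z • L.domain.subtype + L.toFun
  have hM : ∀ u, M u = z • (u : H) + L u := fun u => rfl
  have hinj : Function.Injective M := by
    rw [← LinearMap.ker_eq_bot, LinearMap.ker_eq_bot']
    intro u hu
    have := hcoer u
    rw [← hM, hu, norm_zero] at this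
    have h1 : ‖(u : H)‖ ≤ 0 := by
      by_contra h; push Not at h; nlinarith [mul_pos hc h]
    exact Subtype.ext (norm_le_zero_iff.1 h1)
  have hclosed : IsClosed (LinearMap.range M : Set H) := by
    rw [← isSeqClosed_iff_isClosed]
    intro f g hf hg
    choose u hu using hf
    have hcau : CauchySeq (fun k => (u k : H)) := by
      have hfc := hg.cauchySeq
      rw [Metric.cauchySeq_iff'] at hfc ⊢
      intro ε hε
      obtain ⟨N, hN⟩ := hfc (c * ε) (mul_pos hc hε)
      refine ⟨N, fun k hk => ?_⟩
      have h1 := hN k hk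
      have h2 := hcoer (u k - u N)
      rw [← hM, map_sub, hu, hu, ← dist_eq_norm] at h2
      rw [dist_eq_norm]
      have h3 : c * ‖((u k - u N : L.domain) : H)‖ < c * ε := lt_of_le_of_lt h2 h1
      exact lt_of_mul_lt_mul_left h3 hc.le
    obtain ⟨w, hw⟩ := cauchySeq_tendsto_of_complete hcau
    have hLu : Tendsto (fun k => L (u k)) atTop (𝓝 (g - z • w)) := by
      have := hg.sub (hw.const_smul z)
      refine this.congr fun k => ?_
      rw [← hu, hM]; abel
    have hgr : (w, g - z • w) ∈ L.graph := by
      have hcl : _root_.IsClosed (L.graph : Set (H × H)) := hL.isClosed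
      refine hcl.mem_of_tendsto (hw.prodMk_nhds hLu) (Eventually.of_forall fun k => ?_)
      exact LinearPMap.mem_graph L (u k)
    rw [LinearPMap.mem_graph_iff] at hgr
    obtain ⟨y, hy1, hy2⟩ := hgr
    refine ⟨y, ?_⟩
    rw [hM, hy2, hy1]; simp
  have hsurj : LinearMap.range M = ⊤ := by
    have : CompleteSpace (LinearMap.range M) := hclosed.completeSpace_coe
    rw [← Submodule.orthogonal_eq_bot_iff, Submodule.eq_bot_iff]
    intro v hv
    have hort : ∀ u : L.domain, inner ℂ (z • (u : H) + L u) v = 0 := fun u =>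
      hv _ ⟨u, rfl⟩
    have hform : ∀ u : L.domain, inner ℂ (-(starRingEnd ℂ z) • v) (u : H) = inner ℂ v (L u) := by
      intro u
      have h1 := hort u
      have h2 : inner ℂ v (z • (u : H) + L u) = 0 := inner_eq_zero_symm.1 h1
      rw [inner_add_right, inner_smul_right] at h2
      rw [inner_smul_left]
      simp
      linear_combination -h2
    have hvdom := LinearPMap.mem_adjoint_domain_of_exists (T := L) v ⟨_, hform⟩
    have hval := LinearPMap.adjoint_apply_eq hL.dense_domain ⟨v, hvdom⟩ hform
    have hadj : L.adjoint = L := hL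
    have hvd : v ∈ L.domain := by rw [← hadj]; exact hvdom
    have hLv : L ⟨v, hvd⟩ = -(starRingEnd ℂ z) • v := by
      rw [← hval]
      exact ((LinearPMap.ext_iff.1 hadj).2 (x := v) (hf := hvdom) (hg := hvd)).symm
    have := hcoer' ⟨v, hvd⟩
    rw [hLv] at this
    simp at this
    have h1 : ‖v‖ ≤ 0 := by
      by_contra h; push Not at h; nlinarith [mul_pos hc' h]
    exact norm_le_zero_iff.1 h1
  let e : L.domain ≃ₗ[ℂ] H := LinearEquiv.ofBijective M ⟨hinj, LinearMap.range_eq_top.1 hsurj⟩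
  have he : ∀ u, e u = z • (u : H) + L u := fun u => rfl
  refine ⟨(L.domain.subtype ∘ₗ e.symm.toLinearMap).mkContinuous c⁻¹ ?_, ?_, ?_⟩
  · intro f
    have h1 := hcoer (e.symm f)
    rw [← he, e.apply_symm_apply] at h1
    change ‖((e.symm f : L.domain) : H)‖ ≤ _
    rw [inv_mul_eq_div, le_div_iff₀ hc]
    linarith
  · intro u
    change ((e.symm (z • (u : H) + L u) : L.domain) : H) = u
    rw [← he, e.symm_apply_apply]
  · intro f
    exact ⟨(e.symm f).2, e.apply_symm_apply f⟩

theorem shiftInv_one_apply {L : H →ₗ.[ℂ] H} (hL : IsSelfAdjoint L) (h0 : NonNegative L) (f : H) :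
    ∃ u : L.domain, shiftInv L 1 f = u ∧ f = (u : H) + L u := by
  obtain ⟨h, h1⟩ := (isShiftInverse_of_mem_slitPlane hL h0 Complex.one_mem_slitPlane).2 f
  rw [one_smul] at h1
  exact ⟨⟨_, h⟩, rfl, h1.symm⟩

theorem shiftInv_one_nonneg {L : H →ₗ.[ℂ] H} (hL : IsSelfAdjoint L) (h0 : NonNegative L) :
    0 ≤ shiftInv L 1 := by
  rw [ContinuousLinearMap.nonneg_iff_isPositive, ContinuousLinearMap.isPositive_iff_complex]
  intro f
  obtain ⟨u, hu, hf⟩ := shiftInv_one_apply hL h0 f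
  have h1 : inner ℂ (shiftInv L 1 f) f = ((‖(u : H)‖ ^ 2 + (inner ℂ (L u) (u : H)).re : ℝ) : ℂ) := by
    rw [hu, hf, inner_add_right, inner_self_eq_norm_sq_to_K, ← inner_symm hL]
    apply Complex.ext
    · simp [← Complex.ofReal_pow]
    · simp [inner_self_im hL, ← Complex.ofReal_pow]
  rw [h1]
  refine ⟨rfl, ?_⟩
  change 0 ≤ ‖_‖ ^ 2 + (inner ℂ (L u) (u : H)).re
  exact add_nonneg (sq_nonneg _) (h0 u)

theorem shiftInv_one_le_one {L : H →ₗ.[ℂ] H} (hL : IsSelfAdjoint L) (h0 : NonNegative L) :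
    shiftInv L 1 ≤ 1 := by
  rw [ContinuousLinearMap.le_def, ContinuousLinearMap.isPositive_iff_complex]
  intro f
  obtain ⟨u, hu, hf⟩ := shiftInv_one_apply hL h0 f
  have h1 : inner ℂ ((1 - shiftInv L 1) f) f =
      ((‖L u‖ ^ 2 + (inner ℂ (L u) (u : H)).re : ℝ) : ℂ) := by
    have h2 : (1 - shiftInv L 1) f = L u := by
      change f - shiftInv L 1 f = L u
      rw [hu]; nth_rw 1 [hf]; abel
    rw [h2, hf, inner_add_right, inner_self_eq_norm_sq_to_K]
    apply Complex.ext
    · simp [← Complex.ofReal_pow]; ring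
    · simp [inner_self_im hL, ← Complex.ofReal_pow]
  rw [h1]
  refine ⟨rfl, ?_⟩
  change 0 ≤ ‖_‖ ^ 2 + (inner ℂ (L u) (u : H)).re
  exact add_nonneg (sq_nonneg _) (h0 u)

theorem spectrum_shiftInv_one {L : H →ₗ.[ℂ] H} (hL : IsSelfAdjoint L) (h0 : NonNegative L) :
    spectrum ℝ (shiftInv L 1) ⊆ Icc 0 1 := by
  intro s hs
  have hsa : IsSelfAdjoint (shiftInv L 1) := .of_nonneg (shiftInv_one_nonneg hL h0)
  refine ⟨spectrum_nonneg_of_nonneg (shiftInv_one_nonneg hL h0) hs, ?_⟩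
  have h := shiftInv_one_le_one hL h0
  rw [← map_one (algebraMap ℝ (H →L[ℂ] H)), le_algebraMap_iff_spectrum_le] at h
  exact h s hs

theorem expSymbol_nonneg (t s : ℝ) : 0 ≤ expSymbol t s := by
  unfold expSymbol
  split_ifs
  · positivity
  · exact le_rfl

theorem expSymbol_le {t : ℝ} (ht : 0 < t) (s : ℝ) :
    expSymbol t s ≤ (2 * Real.exp t / t ^ 2) * s ^ 2 := by
  unfold expSymbol
  split_ifs with h
  · have h1 := Real.quadratic_le_exp_of_nonneg (x := t * s⁻¹) (by positivity)
    have h2 : (t * s⁻¹) ^ 2 / 2 ≤ Real.exp (t * s⁻¹) := by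
      have : 0 < t * s⁻¹ := by positivity
      linarith
    have h3 : Real.exp (-(t * (s⁻¹ - 1))) = Real.exp t / Real.exp (t * s⁻¹) := by
      rw [← Real.exp_sub]; congr 1; ring
    rw [h3, div_le_iff₀ (Real.exp_pos _)]
    calc Real.exp t = (2 * Real.exp t / t ^ 2) * s ^ 2 * ((t * s⁻¹) ^ 2 / 2) := by
          field_simp
      _ ≤ _ := by gcongr
  · positivity

/-- The symbol of `L e^{-tL}`. -/
def genSymbol (t s : ℝ) : ℝ := (s⁻¹ - 1) * expSymbol t s

theorem continuousOn_of_le {g : ℝ → ℝ} (K : ℝ) (h1 : ContinuousOn g (Ioi 0)) (h2 : g 0 = 0)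
    (h3 : ∀ s ∈ Icc (0 : ℝ) 1, |g s| ≤ K * s) : ContinuousOn g (Icc 0 1) := by
  intro s hs
  rcases hs.1.eq_or_lt with h | h
  · subst h
    unfold ContinuousWithinAt
    rw [h2]
    refine squeeze_zero_norm' (a := fun s => K * s) ?_ ?_
    · filter_upwards [self_mem_nhdsWithin] with s hs using h3 s hs
    · have : Tendsto (fun s : ℝ => K * s) (𝓝 0) (𝓝 (K * 0)) := by
        apply Continuous.tendsto; fun_prop
      rw [mul_zero] at this
      exact this.mono_left nhdsWithin_le_nhds
  · exact (h1.continuousAt (Ioi_mem_nhds h)).continuousWithinAt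

theorem continuousOn_expSymbol_Ioi (t : ℝ) : ContinuousOn (expSymbol t) (Ioi 0) := by
  have : ContinuousOn (fun s : ℝ => Real.exp (-(t * (s⁻¹ - 1)))) (Ioi 0) := by
    have : ContinuousOn (fun s : ℝ => s⁻¹) (Ioi 0) :=
      continuousOn_inv₀.mono fun s hs => ne_of_gt hs
    fun_prop
  exact this.congr fun s hs => if_pos hs

theorem continuousOn_expSymbol {t : ℝ} (ht : 0 < t) : ContinuousOn (expSymbol t) (Icc 0 1) := by
  refine continuousOn_of_le (2 * Real.exp t / t ^ 2) (continuousOn_expSymbol_Ioi t)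
    (if_neg (lt_irrefl _)) fun s hs => ?_
  rw [abs_of_nonneg (expSymbol_nonneg t s)]
  refine (expSymbol_le ht s).trans ?_
  have : s ^ 2 ≤ s := by nlinarith [hs.1, hs.2]
  gcongr

theorem continuousOn_genSymbol {t : ℝ} (ht : 0 < t) : ContinuousOn (genSymbol t) (Icc 0 1) := by
  refine continuousOn_of_le (2 * Real.exp t / t ^ 2) ?_ ?_ fun s hs => ?_
  · have : ContinuousOn (fun s : ℝ => s⁻¹) (Ioi 0) :=
      continuousOn_inv₀.mono fun s hs => ne_of_gt hs
    exact (this.sub continuousOn_const).mul (continuousOn_expSymbol_Ioi t)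
  · simp [genSymbol, expSymbol]
  · rcases hs.1.eq_or_lt with h | h
    · subst h; simp [genSymbol, expSymbol]
    · have h1 : 1 ≤ s⁻¹ := (one_le_inv₀ h).2 hs.2
      have h2 := expSymbol_nonneg t s
      unfold genSymbol
      rw [abs_of_nonneg (mul_nonneg (by linarith) h2)]
      calc (s⁻¹ - 1) * expSymbol t s ≤ s⁻¹ * ((2 * Real.exp t / t ^ 2) * s ^ 2) := by
            apply mul_le_mul (by linarith) (expSymbol_le ht s) h2 (by linarith)
        _ = _ := by field_simp

theorem abs_exp_sub_le (y : ℝ) : |Real.exp y - 1 - y| ≤ 2 * y ^ 2 * Real.exp |y| := by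
  have h1 : 1 + |y| ≤ Real.exp |y| := by linarith [Real.add_one_le_exp |y|]
  rcases le_or_gt |y| 1 with h | h
  · have h2 := Real.abs_exp_sub_one_sub_id_le h
    nlinarith [sq_nonneg y, abs_nonneg y]
  · have h2 : Real.exp y ≤ Real.exp |y| := Real.exp_le_exp.2 (le_abs_self y)
    have h3 : 1 ≤ y ^ 2 := by rw [← sq_abs]; nlinarith
    have h4 : |Real.exp y - 1 - y| ≤ 2 * Real.exp |y| := by
      rw [abs_le]
      constructor <;> linarith [Real.exp_pos y, le_abs_self y, neg_abs_le y]
    nlinarith [Real.exp_pos |y|]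

theorem expSymbol_taylor {t h : ℝ} (ht : 0 < t) (hh : |h| ≤ t / 2) {s : ℝ} (hs : s ∈ Icc (0 : ℝ) 1) :
    |expSymbol (t + h) s - expSymbol t s + h * genSymbol t s| ≤
      (2 * (2 * Real.exp (t / 2) / (t / 2) ^ 2)) * h ^ 2 := by
  have hK := expSymbol_le (half_pos ht) s
  rcases hs.1.eq_or_lt with h0 | h0
  · subst h0
    simp only [genSymbol, expSymbol, lt_irrefl, if_false]
    simp only [sub_zero, mul_zero, add_zero, abs_zero]
    positivity
  · have hx : 0 ≤ s⁻¹ - 1 := by linarith [(one_le_inv₀ h0).2 hs.2]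
    have hxs : s⁻¹ - 1 ≤ s⁻¹ := by linarith
    unfold genSymbol expSymbol at *
    rw [if_pos h0] at *
    rw [if_pos h0]
    set x := s⁻¹ - 1 with hxdef
    have e1 : Real.exp (-((t + h) * x)) - Real.exp (-(t * x)) + h * (x * Real.exp (-(t * x))) =
        Real.exp (-(t * x)) * (Real.exp (-(h * x)) - 1 - (-(h * x))) := by
      have : Real.exp (-((t + h) * x)) = Real.exp (-(t * x)) * Real.exp (-(h * x)) := by
        rw [← Real.exp_add]; congr 1; ring
      rw [this]; ring
    rw [e1, abs_mul, abs_of_pos (Real.exp_pos _)]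
    have h2 := abs_exp_sub_le (-(h * x))
    have h3 : |-(h * x)| ≤ t / 2 * x := by
      rw [abs_neg, abs_mul, abs_of_nonneg hx]; gcongr
    calc Real.exp (-(t * x)) * |Real.exp (-(h * x)) - 1 - (-(h * x))|
        ≤ Real.exp (-(t * x)) * (2 * (-(h * x)) ^ 2 * Real.exp (t / 2 * x)) := by
          refine mul_le_mul_of_nonneg_left (h2.trans ?_) (Real.exp_pos _).le
          gcongr
      _ = 2 * h ^ 2 * x ^ 2 * Real.exp (-(t / 2 * x)) := by
          have : Real.exp (-(t / 2 * x)) = Real.exp (-(t * x)) * Real.exp (t / 2 * x) := by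
            rw [← Real.exp_add]; congr 1; ring
          rw [this]; ring
      _ ≤ 2 * h ^ 2 * (s⁻¹) ^ 2 * ((2 * Real.exp (t / 2) / (t / 2) ^ 2) * s ^ 2) := by
          gcongr
      _ = _ := by field_simp

theorem semigroup_mem_domain {L : H →ₗ.[ℂ] H} (hL : IsSelfAdjoint L) (h0 : NonNegative L)
    {t : ℝ} (ht : 0 < t) (f : H) : ∃ h : semigroup L t f ∈ L.domain,
      L ⟨semigroup L t f, h⟩ = cfc (genSymbol t) (shiftInv L 1) f := by
  have hsp := spectrum_shiftInv_one hL h0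
  have hsa : IsSelfAdjoint (shiftInv L 1) := .of_nonneg (shiftInv_one_nonneg hL h0)
  have hc1 := (continuousOn_expSymbol ht).mono hsp
  have hc2 := (continuousOn_genSymbol ht).mono hsp
  have key : shiftInv L 1 * (cfc (genSymbol t) (shiftInv L 1) + semigroup L t) =
      semigroup L t := by
    unfold semigroup
    rw [← cfc_add (shiftInv L 1) _ _ hc2 hc1]
    nth_rw 1 [← cfc_id' ℝ (shiftInv L 1) hsa]
    rw [← cfc_mul (fun s => s) (fun s => genSymbol t s + expSymbol t s) _ continuousOn_id
      (hc2.add hc1)]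
    refine cfc_congr fun s hs => ?_
    rcases (hsp hs).1.eq_or_lt with h | h
    · subst h; simp [expSymbol]
    · simp only [genSymbol]; field_simp; ring
  have hk : shiftInv L 1 (cfc (genSymbol t) (shiftInv L 1) f + semigroup L t f) =
      semigroup L t f := congrArg (fun T : H →L[ℂ] H => T f) key
  obtain ⟨u, hu, hf⟩ := shiftInv_one_apply hL h0
    (cfc (genSymbol t) (shiftInv L 1) f + semigroup L t f)
  have hu' : semigroup L t f = u := hk.symm.trans hu
  refine ⟨hu' ▸ u.2, ?_⟩
  have : (⟨semigroup L t f, hu' ▸ u.2⟩ : L.domain) = u := Subtype.ext hu'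
  rw [this]
  rw [hu', add_comm] at hf
  exact (add_left_cancel hf).symm

/-- `t ↦ e^{-tL} f` solves `u' = -L u` on `(0, ∞)` for every `f`. -/
theorem semigroup_hasDerivAt {L : H →ₗ.[ℂ] H} (hL : IsSelfAdjoint L) (h0 : NonNegative L)
    {t : ℝ} (ht : 0 < t) (f : H) : ∃ h : semigroup L t f ∈ L.domain,
      HasDerivAt (fun τ => semigroup L τ f) (-(L ⟨semigroup L t f, h⟩)) t := by
  obtain ⟨h, hval⟩ := semigroup_mem_domain hL h0 ht f
  refine ⟨h, ?_⟩
  rw [hval]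
  have hsp := spectrum_shiftInv_one hL h0
  set K := 2 * (2 * Real.exp (t / 2) / (t / 2) ^ 2) with hK
  have hc2 := (continuousOn_genSymbol ht).mono hsp
  have hbd : ∀ r : ℝ, |r| ≤ t / 2 →
      ‖semigroup L (t + r) - semigroup L t + r • cfc (genSymbol t) (shiftInv L 1)‖ ≤
        K * r ^ 2 := by
    intro r hr
    have htr : 0 < t + r := by linarith [neg_abs_le r]
    have hc1 := (continuousOn_expSymbol ht).mono hsp
    have hc3 := (continuousOn_expSymbol htr).mono hsp
    unfold semigroup
    rw [← cfc_const_mul r _ _ hc2,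
      ← cfc_sub (a := shiftInv L 1) (expSymbol (t + r)) (expSymbol t) (hf := hc3) (hg := hc1),
      ← cfc_add (shiftInv L 1) (fun s => expSymbol (t + r) s - expSymbol t s)
        (fun s => r * genSymbol t s) (hc3.sub hc1) (continuousOn_const.mul hc2)]
    exact norm_cfc_le (by positivity) fun s hs => expSymbol_taylor ht hr (hsp hs)
  rw [hasDerivAt_iff_isLittleO_nhds_zero]
  have hO : (fun r : ℝ => semigroup L (t + r) f - semigroup L t f -
      r • -(cfc (genSymbol t) (shiftInv L 1) f)) =O[𝓝 0] fun r : ℝ => r ^ 2 := by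
    refine Asymptotics.IsBigO.of_bound (K * ‖f‖) ?_
    filter_upwards [Metric.closedBall_mem_nhds (0 : ℝ) (half_pos ht)] with r hr
    have hr' : |r| ≤ t / 2 := by simpa using hr
    have h1 := (semigroup L (t + r) - semigroup L t +
      r • cfc (genSymbol t) (shiftInv L 1)).le_of_opNorm_le (hbd r hr') f
    have h2 : (semigroup L (t + r) - semigroup L t +
      r • cfc (genSymbol t) (shiftInv L 1)) f = semigroup L (t + r) f - semigroup L t f -
      r • -(cfc (genSymbol t) (shiftInv L 1) f) := by
      rw [smul_neg, sub_neg_eq_add]; rfl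
    rw [h2] at h1
    rw [Real.norm_of_nonneg (sq_nonneg r)]
    exact h1.trans_eq (by ring)
  refine hO.trans_isLittleO ?_
  simpa using Asymptotics.isLittleO_pow_pow (𝕜 := ℝ) (m := 1) (n := 2) (by norm_num)

/-- `e^{-tL} f` tends to `f` as `t → 0+`. -/
theorem semigroup_tendsto {L : H →ₗ.[ℂ] H} (hL : IsSelfAdjoint L) (h0 : NonNegative L) (f : H) :
    Tendsto (fun t => semigroup L t f) (𝓝[>] 0) (𝓝 f) := by
  have hsp := spectrum_shiftInv_one hL h0
  have hsa : IsSelfAdjoint (shiftInv L 1) := .of_nonneg (shiftInv_one_nonneg hL h0)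
  have hexp : ∀ t : ℝ, 0 < t → ∀ s ∈ Icc (0 : ℝ) 1, expSymbol t s ≤ 1 ∧ s - t ≤ expSymbol t s * s := by
    intro t ht s hs
    rcases hs.1.eq_or_lt with h | h
    · subst h; simp [expSymbol, ht.le]
    · have hx : 0 ≤ s⁻¹ - 1 := by linarith [(one_le_inv₀ h).2 hs.2]
      unfold expSymbol
      rw [if_pos h]
      refine ⟨Real.exp_le_one_iff.2 (by nlinarith), ?_⟩
      have h1 := Real.add_one_le_exp (-(t * (s⁻¹ - 1)))
      have h2 : (-(t * (s⁻¹ - 1)) + 1) * s = s - t + t * s := by field_simp; ring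
      nlinarith [mul_pos ht h]
  have hnorm : ∀ t : ℝ, 0 < t → ‖semigroup L t‖ ≤ 1 := fun t ht =>
    norm_cfc_le zero_le_one fun s hs => by
      rw [Real.norm_of_nonneg (expSymbol_nonneg t s)]; exact (hexp t ht s (hsp hs)).1
  have hR : ∀ t : ℝ, 0 < t → ‖semigroup L t * shiftInv L 1 - shiftInv L 1‖ ≤ t := by
    intro t ht
    have hc1 := (continuousOn_expSymbol ht).mono hsp
    have e : semigroup L t * shiftInv L 1 - shiftInv L 1 =
        cfc (fun s => expSymbol t s * s - s) (shiftInv L 1) := by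
      rw [cfc_sub (a := shiftInv L 1) (fun s => expSymbol t s * s) (fun s => s)
          (hf := hc1.mul continuousOn_id) (hg := continuousOn_id),
        cfc_mul (expSymbol t) (fun s => s) _ hc1 continuousOn_id, cfc_id' ℝ (shiftInv L 1) hsa]
      rfl
    rw [e]
    refine norm_cfc_le ht.le fun s hs => ?_
    have h1 := hexp t ht s (hsp hs)
    have h2 := (hsp hs).1
    rw [Real.norm_eq_abs, abs_le]
    constructor <;> nlinarith
  rw [Metric.tendsto_nhds]
  intro ε hε
  obtain ⟨g, hg, hgd⟩ := Metric.mem_closure_iff.1 (hL.dense_domain f) (ε / 4) (by positivity)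
  obtain ⟨w, hw⟩ : ∃ w, shiftInv L 1 w = g :=
    ⟨_, (isShiftInverse_of_mem_slitPlane hL h0 Complex.one_mem_slitPlane).1 ⟨g, hg⟩⟩
  have hlim : Tendsto (fun t : ℝ => t * ‖w‖) (𝓝[>] 0) (𝓝 0) := by
    have : Tendsto (fun t : ℝ => t * ‖w‖) (𝓝 0) (𝓝 (0 * ‖w‖)) := by
      apply Continuous.tendsto; fun_prop
    rw [zero_mul] at this
    exact this.mono_left nhdsWithin_le_nhds
  filter_upwards [self_mem_nhdsWithin, hlim.eventually (gt_mem_nhds (half_pos hε))] with t ht hts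
  have h1 : ‖semigroup L t g - g‖ ≤ t * ‖w‖ := by
    have := (semigroup L t * shiftInv L 1 - shiftInv L 1).le_of_opNorm_le (hR t ht) w
    rw [← hw]; exact this
  have h2 : ‖semigroup L t (f - g)‖ ≤ 1 * ‖f - g‖ :=
    (semigroup L t).le_of_opNorm_le (hnorm t ht) _
  rw [dist_eq_norm] at hgd ⊢
  have h3 : semigroup L t f - f = semigroup L t (f - g) + (semigroup L t g - g) - (f - g) := by
    rw [map_sub]; abel
  rw [h3]
  have h4 := norm_sub_le (semigroup L t (f - g) + (semigroup L t g - g)) (f - g)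
  have h5 := norm_add_le (semigroup L t (f - g)) (semigroup L t g - g)
  linarith

end Abstract

section Concrete

variable {D n : ℕ}

/-- The Hilbert space `L²(Ω, ℂⁿ)` over Lebesgue measure on `Ω ⊆ ℝ^D`. -/
abbrev LTwo (Ω : Set (EuclideanSpace ℝ (Fin D))) (n : ℕ) : Type :=
  Lp (EuclideanSpace ℂ (Fin n)) 2 (volume.restrict Ω)

variable {Ω : Set (EuclideanSpace ℝ (Fin D))}

/-- Multiplication by the characteristic function of the ball `B(x, r)` on `L²(Ω, ℂⁿ)`. -/
def ballCutoff (x : EuclideanSpace ℝ (Fin D)) (r : ℝ) (f : LTwo Ω n) : LTwo Ω n :=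
  ((Lp.memLp f).indicator (s := Metric.ball x r) measurableSet_ball).toLp
    ((Metric.ball x r).indicator f)

/-- The two-ball norm `‖1_{B(x,r)} T 1_{B(y,r)}‖_{L^p → L^q}` of a bounded operator `T` on
`L²(Ω, ℂⁿ)`: the supremum of `‖1_{B(x,r)} T (1_{B(y,r)} f)‖_q` over all `f ∈ L^p ∩ L²` with
`‖f‖_p ≤ 1`. Its value is `∞` if the operator is not bounded from `L^p` to `L^q`. -/
def twoBallNorm (p q : ℝ≥0∞) (T : LTwo Ω n →L[ℂ] LTwo Ω n) (x y : EuclideanSpace ℝ (Fin D))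
    (r : ℝ) : ℝ≥0∞ :=
  ⨆ (f : LTwo Ω n) (_ : eLpNorm f p (volume.restrict Ω) ≤ 1),
    eLpNorm (ballCutoff x r (T (ballCutoff y r f))) q (volume.restrict Ω)

/-- The exponent `(D/m) (1/p - 1/q)`. -/
def smoothingExp (D : ℕ) (m : ℝ) (p q : ℝ≥0∞) : ℝ :=
  (D : ℝ) / m * ((1 / p).toReal - (1 / q).toReal)

/-- Two-ball `L^p → L^q` bounds for `z (z + L)⁻¹`, uniformly in the sector `|arg z| < φ`. -/
def ResolventBounds (L : LTwo Ω n →ₗ.[ℂ] LTwo Ω n) (m : ℝ) (p q : ℝ≥0∞) (φ : ℝ) : Prop :=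
  ∃ b C : ℝ, 0 < b ∧ 0 < C ∧ ∀ x ∈ Ω, ∀ y ∈ Ω, ∀ z : ℂ, z ≠ 0 → |z.arg| < φ →
    twoBallNorm p q (z • shiftInv L z) x y (‖z‖ ^ (-(1 / m))) ≤
      ENNReal.ofReal (C * ‖z‖ ^ smoothingExp D m p q * Real.exp (-(b * ‖z‖ ^ (1 / m) * ‖x - y‖)))

/-- Generalized Gaussian two-ball `L^p → L^q` bounds of order `m` for `e^{-tL}`, `t > 0`. -/
def SemigroupBounds (L : LTwo Ω n →ₗ.[ℂ] LTwo Ω n) (m : ℝ) (p q : ℝ≥0∞) : Prop :=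
  ∃ b C : ℝ, 0 < b ∧ 0 < C ∧ ∀ t : ℝ, 0 < t → ∀ x ∈ Ω, ∀ y ∈ Ω,
    twoBallNorm p q (semigroup L t) x y (t ^ (1 / m)) ≤
      ENNReal.ofReal (C * t ^ (-smoothingExp D m p q) *
        Real.exp (-(b * (‖x - y‖ / t ^ (1 / m)) ^ (m / (m - 1)))))

end Concrete

end TwoBall

end

namespace TwoBall

/-! ### Resolvent: norm bound on the right half-plane, continuity, holomorphy, Cauchy's formula. -/

section Resolvent

variable {H : Type*} [NormedAddCommGroup H] [InnerProductSpace ℂ H] [CompleteSpace H]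
  {L : H →ₗ.[ℂ] H}

/-! The resolvent and the semigroup are Laplace transforms of one another; two-ball bounds pass
through such integrals by Minkowski's inequality, which gives both implications once two obstacles
are removed.

The first is that the radius of the balls is tied to the spectral parameter (`t^{1/m}` or
`|λ|^{-1/m}`), whereas under an integral the radius must stay fixed while the parameter varies.
`twoBallNorm_le_of_small_scale` decouples them. Cut space into cubes of diameter below the natural
scale `s` and group the blocks `1_{Q_j} T 1_{Q_k}` by the shift `l = j - k`. For fixed `l` the
operator is block-diagonal, so its `L^p → L^q` norm is controlled by its largest block because `p ≤
q`; exponential decay makes the sum over `l` converge to a constant independent of the radius.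

From the semigroup to the resolvent, integrate `e^{-zt} e^{-tL}` over `t > 0`. Young's inequality
with exponents `m` and `m/(m-1)` turns part of `e^{-Re z t}` and the Gaussian factor into
`e^{-β|z|^{1/m}|x-y|}`. What remains is a Gamma integral of `t^{-α}`, with `α = (D/m)(1/p - 1/q)`,
convergent because `α < 1`.

From the resolvent to the semigroup, the second obstacle is that the inverse Laplace integral of `(z
+ L)⁻¹` along a vertical line does not converge absolutely. So `t e^{-tL}` is recovered from `(z +
L)⁻²` instead (`smul_semigroup_eq_integral`). Two-ball bounds for the square follow from those for
the resolvent by Cauchy's formula on discs of radius comparable to `|z|`; these discs fit into the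
sector because it is wider than the right half-plane. The bound `|z|^{α-2}` is integrable on the
line as `α < 1`, and the abscissa `R` is free: optimising `e^{Rt - cR^{1/m}|x-y|}` over `R` produces
the exponent `m/(m-1)`. -/

theorem mem_slitPlane_of_re_pos {z : ℂ} (hz : 0 < z.re) : z ∈ Complex.slitPlane := Or.inl hz

/-- Adding a non-negative real number to a complex number with non-negative real part cannot
decrease its modulus; applied to `⟨u, (z + L)u⟩` this gives the constant `‖z‖` itself, whose growth
along vertical lines makes `(z + L)⁻²` integrable there. -/
theorem norm_smul_le_norm_shift (hL : IsSelfAdjoint L) (h0 : NonNegative L) {z : ℂ}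
    (hz : 0 ≤ z.re) (u : L.domain) : ‖z‖ * ‖(u : H)‖ ≤ ‖z • (u : H) + L u‖ := by
  have comp : inner ℂ (u : H) (z • (u : H) + L u) =
      z * ((‖(u : H)‖ ^ 2 : ℝ) : ℂ) + ((inner ℂ (L u) (u : H)).re : ℂ) := by
    rw [inner_add_right, inner_smul_right, inner_self_eq_norm_sq_to_K, ← inner_symm hL]
    congr 1
    · simp
    · apply Complex.ext
      · simp
      · simp [inner_self_im hL]
  have h1 := norm_inner_le_norm (𝕜 := ℂ) (u : H) (z • (u : H) + L u)
  have h2 : ‖z‖ * ‖(u : H)‖ ^ 2 ≤ ‖inner ℂ (u : H) (z • (u : H) + L u)‖ := by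
    rw [comp]
    refine le_of_sq_le_sq ?_ (norm_nonneg _)
    set a := ‖(u : H)‖ ^ 2
    have ha : 0 ≤ a := sq_nonneg _
    have hb := h0 u
    set c := (inner ℂ (L u) (u : H)).re
    rw [mul_pow, Complex.sq_norm, Complex.sq_norm, Complex.normSq_apply, Complex.normSq_apply]
    simp only [Complex.add_re, Complex.add_im, Complex.re_mul_ofReal, Complex.im_mul_ofReal,
      Complex.ofReal_re, Complex.ofReal_im, add_zero]
    nlinarith [mul_nonneg (mul_nonneg hz ha) hb, mul_self_nonneg c]
  rcases (norm_nonneg (u : H)).eq_or_lt with h3 | h3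
  · rw [← h3]; simp
  · refine le_of_mul_le_mul_left ?_ h3
    calc _ = ‖z‖ * ‖(u : H)‖ ^ 2 := by ring
      _ ≤ _ := h2.trans h1

theorem norm_shiftInv_le (hL : IsSelfAdjoint L) (h0 : NonNegative L) {z : ℂ}
    (hz : 0 < z.re) : ‖shiftInv L z‖ ≤ ‖z‖⁻¹ := by
  have hz0 : 0 < ‖z‖ := norm_pos_iff.2 fun h => by simp [h] at hz
  refine ContinuousLinearMap.opNorm_le_bound _ (by positivity) fun f => ?_
  obtain ⟨h, h1⟩ := (isShiftInverse_of_mem_slitPlane hL h0 (mem_slitPlane_of_re_pos hz)).2 f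
  have h2 := norm_smul_le_norm_shift hL h0 hz.le ⟨_, h⟩
  rw [h1] at h2
  rw [inv_mul_eq_div, le_div_iff₀ hz0, mul_comm]
  exact h2

theorem shiftInv_apply_domain (hL : IsSelfAdjoint L) (h0 : NonNegative L) {z : ℂ}
    (hz : z ∈ Complex.slitPlane) (u : L.domain) :
    shiftInv L z (L u) = u - z • shiftInv L z u := by
  have h := (isShiftInverse_of_mem_slitPlane hL h0 hz).1 u
  rw [map_add, map_smul] at h
  exact eq_sub_of_add_eq' h

theorem shiftInv_sub_shiftInv (hL : IsSelfAdjoint L) (h0 : NonNegative L) {z w : ℂ}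
    (hz : z ∈ Complex.slitPlane) (hw : w ∈ Complex.slitPlane) :
    shiftInv L w - shiftInv L z = (z - w) • (shiftInv L w * shiftInv L z) := by
  ext f
  obtain ⟨h, h1⟩ := (isShiftInverse_of_mem_slitPlane hL h0 hz).2 f
  have h2 := shiftInv_apply_domain hL h0 hw ⟨_, h⟩
  have h3 : L ⟨_, h⟩ = f - z • shiftInv L z f := by rw [eq_sub_iff_add_eq', h1]
  rw [h3, map_sub, map_smul] at h2
  change shiftInv L w f - shiftInv L z f = (z - w) • shiftInv L w (shiftInv L z f)
  rw [sub_smul]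
  have h4 := congrArg (fun v => v + z • shiftInv L w (shiftInv L z f)) h2
  simp only [sub_add_cancel] at h4
  rw [h4]
  abel

theorem continuousAt_shiftInv (hL : IsSelfAdjoint L) (h0 : NonNegative L) {z : ℂ}
    (hz : z ∈ Complex.slitPlane) : ContinuousAt (shiftInv L) z := by
  set K := ‖shiftInv L z‖ + 1 with hK
  have hKpos : 0 < K := by positivity
  have hlim : Tendsto (fun w : ℂ => ‖z - w‖ * (2 * K * K)) (𝓝 z) (𝓝 0) := by
    have : Tendsto (fun w : ℂ => ‖z - w‖ * (2 * K * K)) (𝓝 z) (𝓝 (‖z - z‖ * (2 * K * K))) := by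
      apply Continuous.tendsto; fun_prop
    simpa using this
  have hev : ∀ᶠ w in 𝓝 z, ‖z - w‖ * (2 * K * K) < K :=
    hlim.eventually (gt_mem_nhds hKpos)
  rw [ContinuousAt, tendsto_iff_norm_sub_tendsto_zero]
  refine squeeze_zero' (Eventually.of_forall fun _ => norm_nonneg _) ?_ hlim
  filter_upwards [hev, Complex.isOpen_slitPlane.mem_nhds hz] with w hw hws
  have hid := shiftInv_sub_shiftInv hL h0 hz hws
  have h1 : ‖shiftInv L w - shiftInv L z‖ ≤ ‖z - w‖ * (‖shiftInv L w‖ * K) := by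
    rw [hid, norm_smul]
    gcongr
    refine (norm_mul_le _ _).trans ?_
    gcongr
    linarith
  -- Absorption: for `w` close to `z`, the resolvent identity bounds `‖shiftInv L w‖` by half of
  -- itself plus `K`.
  have h2 : ‖shiftInv L w‖ ≤ 2 * K := by
    have h3 : ‖shiftInv L w‖ ≤ ‖shiftInv L w - shiftInv L z‖ + ‖shiftInv L z‖ := by
      simpa using norm_add_le (shiftInv L w - shiftInv L z) (shiftInv L z)
    have h4 : ‖z - w‖ * K < 1 / 2 := by
      have : ‖z - w‖ * K * (2 * K) < 1 / 2 * (2 * K) := by linarith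
      exact lt_of_mul_lt_mul_right this (by positivity)
    nlinarith [norm_nonneg (shiftInv L w)]
  refine h1.trans ?_
  gcongr

theorem hasDerivAt_shiftInv_apply (hL : IsSelfAdjoint L) (h0 : NonNegative L) {z : ℂ}
    (hz : z ∈ Complex.slitPlane) (f : H) :
    HasDerivAt (fun w => shiftInv L w f) (-(shiftInv L z (shiftInv L z f))) z := by
  rw [hasDerivAt_iff_tendsto_slope]
  have h1 : Tendsto (fun w => -(shiftInv L w (shiftInv L z f))) (𝓝[≠] z)
      (𝓝 (-(shiftInv L z (shiftInv L z f)))) :=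
    (((continuousAt_shiftInv hL h0 hz).clm_apply continuousAt_const).neg).tendsto.mono_left
      nhdsWithin_le_nhds
  refine h1.congr' ?_
  filter_upwards [self_mem_nhdsWithin,
    nhdsWithin_le_nhds (Complex.isOpen_slitPlane.mem_nhds hz)] with w hw hws
  have hid := congrArg (fun T : H →L[ℂ] H => T f) (shiftInv_sub_shiftInv hL h0 hz hws)
  change shiftInv L w f - shiftInv L z f = (z - w) • shiftInv L w (shiftInv L z f) at hid
  have hne : w - z ≠ 0 := sub_ne_zero.2 hw
  rw [slope_def_module, hid, smul_smul, ← neg_sub w z, mul_neg, inv_mul_cancel₀ hne, neg_one_smul]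

/-- Cauchy's formula for `(z + L)⁻²`. -/
theorem shiftInv_sq_eq_integral (hL : IsSelfAdjoint L) (h0 : NonNegative L) {z : ℂ} {ρ : ℝ}
    (hρ : 0 < ρ) (hz : Metric.closedBall z ρ ⊆ Complex.slitPlane) (f : H) :
    shiftInv L z (shiftInv L z f) = ∫ φ in Ioc 0 (2 * Real.pi),
      (-((2 * Real.pi * ρ : ℝ) : ℂ)⁻¹ * Complex.exp (-(φ * Complex.I))) •
        shiftInv L (circleMap z ρ φ) f := by
  have hzs : z ∈ Complex.slitPlane := hz (Metric.mem_closedBall_self hρ.le)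
  have h := Complex.two_pi_I_inv_smul_circleIntegral_sub_sq_inv_smul_of_differentiable
    Complex.isOpen_slitPlane hz
    (f := fun w => shiftInv L w f) (fun w hw =>
      (hasDerivAt_shiftInv_apply hL h0 hw f).differentiableAt.differentiableWithinAt)
    (Metric.mem_ball_self hρ)
  rw [(hasDerivAt_shiftInv_apply hL h0 hzs f).deriv, circleIntegral,
    intervalIntegral.integral_of_le Real.two_pi_pos.le, ← integral_smul] at h
  rw [← neg_neg (shiftInv L z (shiftInv L z f)), ← h, ← integral_neg]
  refine integral_congr_ae (Eventually.of_forall fun φ => ?_)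
  simp only [deriv_circleMap, smul_smul, ← neg_smul]
  congr 1
  have h1 : circleMap z ρ φ - z = ρ * Complex.exp (φ * Complex.I) := by simp [circleMap]
  have h2 : (ρ : ℂ) ≠ 0 := by exact_mod_cast hρ.ne'
  have h3 : (Real.pi : ℂ) ≠ 0 := by exact_mod_cast Real.pi_ne_zero
  rw [h1, circleMap_zero, Complex.exp_neg]
  have h4 := Complex.exp_ne_zero (φ * Complex.I)
  have h5 := Complex.I_ne_zero
  push_cast
  field_simp

end Resolvent

/-! ### Laplace transform of the semigroup and its inversion. -/

section Semigroup

variable {H : Type*} [NormedAddCommGroup H] [InnerProductSpace ℂ H] [CompleteSpace H]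
  {L : H →ₗ.[ℂ] H}

theorem norm_semigroup_le_one (hL : IsSelfAdjoint L) (h0 : NonNegative L) {t : ℝ} (ht : 0 < t) :
    ‖semigroup L t‖ ≤ 1 := by
  refine norm_cfc_le zero_le_one fun s hs => ?_
  have hs' := spectrum_shiftInv_one hL h0 hs
  rw [Real.norm_of_nonneg (expSymbol_nonneg t s)]
  unfold expSymbol
  split_ifs with h
  · have : 1 ≤ s⁻¹ := (one_le_inv₀ h).2 hs'.2
    exact Real.exp_le_one_iff.2 (by nlinarith)
  · exact zero_le_one

theorem norm_semigroup_apply_le (hL : IsSelfAdjoint L) (h0 : NonNegative L) {t : ℝ} (ht : 0 < t)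
    (f : H) : ‖semigroup L t f‖ ≤ ‖f‖ := by
  simpa using (semigroup L t).le_of_opNorm_le (norm_semigroup_le_one hL h0 ht) f

theorem continuousOn_semigroup_apply (hL : IsSelfAdjoint L) (h0 : NonNegative L) (f : H) :
    ContinuousOn (fun t => semigroup L t f) (Ioi 0) := fun t ht => by
  obtain ⟨_, h⟩ := semigroup_hasDerivAt hL h0 ht f
  exact h.continuousAt.continuousWithinAt

theorem norm_exp_neg_mul_ofReal (z : ℂ) (t : ℝ) :
    ‖Complex.exp (-(z * t))‖ = Real.exp (-(z.re * t)) := by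
  rw [Complex.norm_exp]; simp

theorem integrableOn_exp_smul_semigroup (hL : IsSelfAdjoint L) (h0 : NonNegative L) (f : H)
    {z : ℂ} (hz : 0 < z.re) :
    IntegrableOn (fun t : ℝ => Complex.exp (-(z * t)) • semigroup L t f) (Ioi 0) := by
  have hg : IntegrableOn (fun t : ℝ => Real.exp (-z.re * t) * ‖f‖) (Ioi 0) :=
    (integrableOn_exp_mul_Ioi (neg_lt_zero.2 hz) 0).mul_const _
  refine hg.mono' ?_ ?_
  · refine ContinuousOn.aestronglyMeasurable ?_ measurableSet_Ioi
    exact (by fun_prop : Continuous fun t : ℝ => Complex.exp (-(z * t))).continuousOn.smul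
      (continuousOn_semigroup_apply hL h0 f)
  · filter_upwards [ae_restrict_mem measurableSet_Ioi] with t ht
    rw [norm_smul, norm_exp_neg_mul_ofReal, neg_mul]
    gcongr
    exact norm_semigroup_apply_le hL h0 ht f

theorem integrableOn_mul_exp_smul_semigroup (hL : IsSelfAdjoint L) (h0 : NonNegative L) (f : H)
    {z : ℂ} (hz : 0 < z.re) :
    IntegrableOn (fun t : ℝ => (t * Complex.exp (-(z * t))) • semigroup L t f) (Ioi 0) := by
  have hg : IntegrableOn (fun t : ℝ => t ^ (1 : ℝ) * Real.exp (-z.re * t ^ (1 : ℝ)) * ‖f‖)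
      (Ioi 0) :=
    (integrableOn_rpow_mul_exp_neg_mul_rpow (by norm_num) one_pos hz).mul_const _
  refine hg.mono' ?_ ?_
  · refine ContinuousOn.aestronglyMeasurable ?_ measurableSet_Ioi
    exact (by fun_prop : Continuous fun t : ℝ => t * Complex.exp (-(z * t))).continuousOn.smul
      (continuousOn_semigroup_apply hL h0 f)
  · filter_upwards [ae_restrict_mem measurableSet_Ioi] with t ht
    rw [norm_smul, norm_mul, norm_exp_neg_mul_ofReal, Complex.norm_real,
      Real.norm_of_nonneg (le_of_lt ht), Real.rpow_one, neg_mul]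
    have ht' : 0 < t := ht
    gcongr
    exact norm_semigroup_apply_le hL h0 ht f

/-- Only the right limit at `a` matters, so the value there may be overwritten. This is needed
because `semigroup L 0` need not be the identity: the symbol for `t = 0` jumps at `s = 0`. -/
theorem integral_Ioi_of_hasDerivAt_of_tendsto_nhdsGT {E : Type*} [NormedAddCommGroup E]
    [NormedSpace ℝ E] [CompleteSpace E] {f f' : ℝ → E} {a : ℝ} {l m : E}
    (hl : Tendsto f (𝓝[>] a) (𝓝 l)) (hderiv : ∀ x ∈ Ioi a, HasDerivAt f (f' x) x)
    (hint : IntegrableOn f' (Ioi a)) (hm : Tendsto f atTop (𝓝 m)) :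
    ∫ x in Ioi a, f' x = m - l := by
  have h := integral_Ioi_of_hasDerivAt_of_tendsto (f := Function.update f a l) (f' := f')
    (a := a) (m := m) ?_ ?_ hint ?_
  · simpa using h
  · rw [continuousWithinAt_update_same]
    simpa using hl
  · intro x hx
    refine (hderiv x hx).congr_of_eventuallyEq ?_
    filter_upwards [Ioi_mem_nhds hx] with y hy
    exact Function.update_of_ne (ne_of_gt hy) _ _
  · refine hm.congr' ?_
    filter_upwards [Ioi_mem_atTop a] with y hy
    exact (Function.update_of_ne (ne_of_gt hy) _ _).symm

theorem hasDerivAt_exp_neg_mul_ofReal (z : ℂ) (t : ℝ) :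
    HasDerivAt (fun τ : ℝ => Complex.exp (-(z * τ))) (-(z * Complex.exp (-(z * t)))) t := by
  have h1 : HasDerivAt (fun τ : ℝ => -(z * (τ : ℂ))) (-(z * 1)) t :=
    ((Complex.ofRealCLM.hasDerivAt (x := t)).const_mul z).neg
  convert h1.cexp using 1
  ring

theorem hasDerivAt_clm_semigroup (hL : IsSelfAdjoint L) (h0 : NonNegative L)
    (T : H →L[ℂ] H) {t : ℝ} (ht : 0 < t) (f : H) : ∃ h : semigroup L t f ∈ L.domain,
      HasDerivAt (fun τ => T (semigroup L τ f)) (-(T (L ⟨semigroup L t f, h⟩))) t := by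
  obtain ⟨h, hd⟩ := semigroup_hasDerivAt hL h0 ht f
  refine ⟨h, ?_⟩
  rw [← map_neg]
  exact (T.restrictScalars ℝ).hasFDerivAt.comp_hasDerivAt t hd

omit [CompleteSpace H] in
theorem tendsto_exp_smul_atTop {z : ℂ} (hz : 0 < z.re) {g : ℝ → H} {K : ℝ}
    (hg : ∀ t, 0 < t → ‖g t‖ ≤ K) :
    Tendsto (fun t : ℝ => Complex.exp (-(z * t)) • g t) atTop (𝓝 0) := by
  have h1 : Tendsto (fun t : ℝ => Real.exp (-(z.re * t)) * K) atTop (𝓝 (0 * K)) := by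
    refine Tendsto.mul_const K (Real.tendsto_exp_neg_atTop_nhds_zero.comp ?_)
    exact tendsto_id.const_mul_atTop hz
  rw [zero_mul] at h1
  refine squeeze_zero_norm' ?_ h1
  filter_upwards [Ioi_mem_atTop 0] with t ht
  rw [norm_smul, norm_exp_neg_mul_ofReal]
  gcongr
  exact hg t ht

omit [CompleteSpace H] in
theorem tendsto_mul_exp_smul_atTop {z : ℂ} (hz : 0 < z.re) {g : ℝ → H} {K : ℝ}
    (hg : ∀ t, 0 < t → ‖g t‖ ≤ K) :
    Tendsto (fun t : ℝ => (t * Complex.exp (-(z * t))) • g t) atTop (𝓝 0) := by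
  have h1 : Tendsto (fun t : ℝ => t ^ (1 : ℝ) * Real.exp (-z.re * t) * K) atTop (𝓝 (0 * K)) :=
    (tendsto_rpow_mul_exp_neg_mul_atTop_nhds_zero 1 _ hz).mul_const K
  rw [zero_mul] at h1
  refine squeeze_zero_norm' ?_ h1
  filter_upwards [Ioi_mem_atTop 0] with t ht
  have ht' : 0 < t := ht
  rw [norm_smul, norm_mul, norm_exp_neg_mul_ofReal, Complex.norm_real,
      Real.norm_of_nonneg (le_of_lt ht), Real.rpow_one, neg_mul]
  gcongr
  exact hg t ht

theorem tendsto_clm_semigroup (hL : IsSelfAdjoint L) (h0 : NonNegative L) (T : H →L[ℂ] H) (f : H) :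
    Tendsto (fun t => T (semigroup L t f)) (𝓝[>] 0) (𝓝 (T f)) :=
  (T.continuous.tendsto f).comp (semigroup_tendsto hL h0 f)

theorem tendsto_cexp_neg_mul_nhdsGT (z : ℂ) :
    Tendsto (fun t : ℝ => Complex.exp (-(z * t))) (𝓝[>] 0) (𝓝 1) := by
  have : Tendsto (fun t : ℝ => Complex.exp (-(z * t))) (𝓝 0)
      (𝓝 (Complex.exp (-(z * (0 : ℝ))))) := by
    apply Continuous.tendsto; fun_prop
  simpa using this.mono_left nhdsWithin_le_nhds

/-- The resolvent is the Laplace transform of the semigroup. -/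
theorem integral_exp_smul_semigroup (hL : IsSelfAdjoint L) (h0 : NonNegative L) (f : H)
    {z : ℂ} (hz : 0 < z.re) :
    ∫ t in Ioi (0 : ℝ), Complex.exp (-(z * t)) • semigroup L t f = shiftInv L z f := by
  have hzs := mem_slitPlane_of_re_pos hz
  rw [integral_Ioi_of_hasDerivAt_of_tendsto_nhdsGT
    -- Antiderivative: since `e^{-tL}` solves `u' = -Lu`, differentiating `-e^{-zt}(z +
    -- L)⁻¹e^{-tL}f` produces `(z + L)⁻¹(z + L)`, which cancels.
    (f := fun t : ℝ => Complex.exp (-(z * t)) • (-shiftInv L z) (semigroup L t f))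
    (l := (1 : ℂ) • (-shiftInv L z) f) (m := 0)]
  · simp
  · exact (tendsto_cexp_neg_mul_nhdsGT z).smul (tendsto_clm_semigroup hL h0 _ f)
  · intro t ht
    obtain ⟨h, hd⟩ := hasDerivAt_clm_semigroup hL h0 (-shiftInv L z) ht f
    refine ((hasDerivAt_exp_neg_mul_ofReal z t).fun_smul hd).congr_deriv ?_
    rw [neg_apply, shiftInv_apply_domain hL h0 hzs]
    simp only [neg_apply]
    module
  · exact integrableOn_exp_smul_semigroup hL h0 f hz
  · refine tendsto_exp_smul_atTop hz (K := ‖-shiftInv L z‖ * ‖f‖) fun t ht => ?_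
    refine ((-shiftInv L z).le_opNorm _).trans ?_
    gcongr
    exact norm_semigroup_apply_le hL h0 ht f

/-- Integration by parts in the Laplace integral suggests the antiderivative `-(t(z + L)⁻¹ + (z +
L)⁻²) e^{-zt} e^{-tL} f`, whose value at `0+` is `-(z + L)⁻² f`. -/
theorem integral_mul_exp_smul_semigroup (hL : IsSelfAdjoint L) (h0 : NonNegative L) (f : H)
    {z : ℂ} (hz : 0 < z.re) :
    ∫ t in Ioi (0 : ℝ), (t * Complex.exp (-(z * t))) • semigroup L t f =
      shiftInv L z (shiftInv L z f) := by
  have hzs := mem_slitPlane_of_re_pos hz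
  rw [integral_Ioi_of_hasDerivAt_of_tendsto_nhdsGT
    (f := fun t : ℝ => (t * Complex.exp (-(z * t))) • (-shiftInv L z) (semigroup L t f) +
      Complex.exp (-(z * t)) • (-(shiftInv L z * shiftInv L z)) (semigroup L t f))
    (l := ((0 : ℝ) * 1 : ℂ) • (-shiftInv L z) f +
      (1 : ℂ) • (-(shiftInv L z * shiftInv L z)) f) (m := 0 + 0)]
  · simp
  · have h1 : Tendsto (fun t : ℝ => (t : ℂ)) (𝓝[>] 0) (𝓝 ((0 : ℝ) : ℂ)) :=
      (Complex.continuous_ofReal.tendsto 0).mono_left nhdsWithin_le_nhds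
    exact ((h1.mul (tendsto_cexp_neg_mul_nhdsGT z)).smul (tendsto_clm_semigroup hL h0 _ f)).add
      ((tendsto_cexp_neg_mul_nhdsGT z).smul (tendsto_clm_semigroup hL h0 _ f))
  · intro t ht
    obtain ⟨h, hd⟩ := hasDerivAt_clm_semigroup hL h0 (-shiftInv L z) ht f
    obtain ⟨_, hd2⟩ := hasDerivAt_clm_semigroup hL h0 (-(shiftInv L z * shiftInv L z)) ht f
    have he := hasDerivAt_exp_neg_mul_ofReal z t
    have hm := (Complex.ofRealCLM.hasDerivAt (x := t)).fun_mul he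
    refine ((hm.fun_smul hd).fun_add (he.fun_smul hd2)).congr_deriv ?_
    have hmul : ∀ v, (shiftInv L z * shiftInv L z) v = shiftInv L z (shiftInv L z v) :=
      fun _ => rfl
    simp only [neg_apply, hmul,
      shiftInv_apply_domain hL h0 hzs, map_sub, map_smul, Complex.ofRealCLM_apply,
      Complex.ofReal_one]
    module
  · exact integrableOn_mul_exp_smul_semigroup hL h0 f hz
  · refine (tendsto_mul_exp_smul_atTop hz (K := ‖-shiftInv L z‖ * ‖f‖) fun t ht => ?_).add
      (tendsto_exp_smul_atTop hz (K := ‖-(shiftInv L z * shiftInv L z)‖ * ‖f‖) fun t ht => ?_)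
    · refine ((-shiftInv L z).le_opNorm _).trans ?_
      gcongr
      exact norm_semigroup_apply_le hL h0 ht f
    · refine ((-(shiftInv L z * shiftInv L z)).le_opNorm _).trans ?_
      gcongr
      exact norm_semigroup_apply_le hL h0 ht f

/-- The point `R + 2πξi` of the vertical line `Re z = R`. -/
noncomputable def linePoint (R ξ : ℝ) : ℂ := R + (2 * Real.pi * ξ : ℝ) * Complex.I

theorem linePoint_re (R ξ : ℝ) : (linePoint R ξ).re = R := by simp [linePoint]

theorem linePoint_im (R ξ : ℝ) : (linePoint R ξ).im = 2 * Real.pi * ξ := by simp [linePoint]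

theorem continuous_linePoint (R : ℝ) : Continuous (linePoint R) := by
  unfold linePoint; fun_prop

theorem integrable_shiftInv_sq_linePoint (hL : IsSelfAdjoint L) (h0 : NonNegative L) (f : H)
    {R : ℝ} (hR : 0 < R) :
    Integrable fun ξ => shiftInv L (linePoint R ξ) (shiftInv L (linePoint R ξ) f) := by
  have hc : Continuous fun ξ => shiftInv L (linePoint R ξ) := by
    rw [continuous_iff_continuousAt]
    intro ξ
    refine ContinuousAt.comp (continuousAt_shiftInv hL h0 (mem_slitPlane_of_re_pos ?_))
      (continuous_linePoint R).continuousAt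
    rwa [linePoint_re]
  have hg : Integrable fun ξ : ℝ => (1 + ((2 * Real.pi / R) * ξ) ^ 2)⁻¹ * ((R ^ 2)⁻¹ * ‖f‖) :=
    (integrable_inv_one_add_sq.comp_mul_left' (by positivity)).mul_const _
  refine hg.mono' (hc.clm_apply (hc.clm_apply continuous_const)).aestronglyMeasurable
    (Eventually.of_forall fun ξ => ?_)
  have hre : 0 < (linePoint R ξ).re := by rwa [linePoint_re]
  have hb := norm_shiftInv_le hL h0 hre
  calc _ ≤ ‖linePoint R ξ‖⁻¹ * (‖linePoint R ξ‖⁻¹ * ‖f‖) :=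
        (ContinuousLinearMap.le_of_opNorm_le _ hb _).trans
          (by gcongr; exact ContinuousLinearMap.le_of_opNorm_le _ hb _)
    _ = (‖linePoint R ξ‖ ^ 2)⁻¹ * ‖f‖ := by rw [← mul_assoc, ← mul_inv, sq]
    _ = _ := by
      rw [Complex.sq_norm, Complex.normSq_apply, linePoint_re, linePoint_im, ← mul_assoc]
      field_simp

/-- The semigroup as an absolutely convergent inverse Laplace transform of `(z + L)⁻²`. -/
theorem smul_semigroup_eq_integral (hL : IsSelfAdjoint L) (h0 : NonNegative L) (f : H)
    {R t : ℝ} (hR : 0 < R) (ht : 0 < t) :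
    ((t * Real.exp (-(R * t)) : ℝ) : ℂ) • semigroup L t f = ∫ ξ : ℝ,
      Complex.exp ((2 * Real.pi * (ξ * t) : ℝ) * Complex.I) •
        shiftInv L (linePoint R ξ) (shiftInv L (linePoint R ξ) f) := by
  -- On the line `Re z = R` the Laplace transform at `R + 2πξi` is the Fourier transform of `G` at
  -- `ξ`. The weight `τ` gives that transform the decay of `(z + L)⁻²`, which Fourier inversion
  -- needs for integrability.
  set G : ℝ → H := (Ioi 0).indicator fun τ => (τ * Complex.exp (-((R : ℂ) * τ))) • semigroup L τ f
    with hG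
  have hGi : Integrable G := by
    rw [hG, integrable_indicator_iff measurableSet_Ioi]
    exact integrableOn_mul_exp_smul_semigroup hL h0 f (z := R) (by simpa using hR)
  have hF : FourierTransform.fourier G =
      fun ξ => shiftInv L (linePoint R ξ) (shiftInv L (linePoint R ξ) f) := by
    ext1 ξ
    rw [Real.fourier_real_eq_integral_exp_smul,
      ← integral_mul_exp_smul_semigroup hL h0 f (z := linePoint R ξ) (by rwa [linePoint_re]),
      ← integral_indicator measurableSet_Ioi]
    congr 1
    ext1 τ
    by_cases hτ : τ ∈ Ioi (0 : ℝ)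
    · rw [hG, indicator_of_mem hτ, indicator_of_mem hτ, smul_smul]
      congr 1
      rw [mul_left_comm, ← Complex.exp_add]
      congr 2
      simp only [linePoint]
      push_cast
      ring
    · rw [hG, indicator_of_notMem hτ, indicator_of_notMem hτ, smul_zero]
  have hcont : ContinuousAt G t := by
    have h1 : ContinuousAt (fun τ : ℝ => (τ * Complex.exp (-((R : ℂ) * τ))) • semigroup L τ f) t :=
      ((by fun_prop : Continuous fun τ : ℝ =>
        τ * Complex.exp (-((R : ℂ) * τ))).continuousAt).smul
        ((continuousOn_semigroup_apply hL h0 f).continuousAt (Ioi_mem_nhds ht))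
    refine h1.congr ?_
    filter_upwards [Ioi_mem_nhds ht] with τ hτ
    rw [hG, indicator_of_mem hτ]
  have hinv := hGi.fourierInv_fourier_eq (by
    rw [hF]; exact integrable_shiftInv_sq_linePoint hL h0 f hR) hcont
  rw [hF, Real.fourierInv_eq', hG, indicator_of_mem (show t ∈ Ioi (0 : ℝ) from ht)] at hinv
  have he : ((t * Real.exp (-(R * t)) : ℝ) : ℂ) = t * Complex.exp (-((R : ℂ) * t)) := by
    push_cast; rfl
  rw [he, ← hinv]
  refine integral_congr_ae (Eventually.of_forall fun ξ => ?_)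
  simp only [RCLike.inner_apply, conj_trivial, mul_comm t]

end Semigroup

/-! ### Minkowski's integral inequality for `L²`-valued integrals. -/

section Minkowski

variable {α E X : Type*} [MeasurableSpace α] {μ : Measure α} [NormedAddCommGroup E]
  [MeasurableSpace X] {ν : Measure X} {q : ℝ≥0∞} {s : Set α}

theorem indicator_coeFn_zero (p : ℝ≥0∞) : s.indicator (0 : Lp E p μ) =ᵐ[μ] 0 := by
  filter_upwards [Lp.coeFn_zero E p μ] with a ha
  by_cases has : a ∈ s
  · rw [indicator_of_mem has, ha]
  · rw [indicator_of_notMem has]; rfl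

theorem indicator_coeFn_smul {𝕜 : Type*} [NormedRing 𝕜] [Module 𝕜 E] [IsBoundedSMul 𝕜 E]
    {p : ℝ≥0∞} (c : 𝕜) (f : Lp E p μ) :
    s.indicator (c • f : Lp E p μ) =ᵐ[μ] c • s.indicator f := by
  filter_upwards [Lp.coeFn_smul c f] with a ha
  rw [Pi.smul_apply]
  by_cases has : a ∈ s
  · rw [indicator_of_mem has, indicator_of_mem has, ha, Pi.smul_apply]
  · rw [indicator_of_notMem has, indicator_of_notMem has, smul_zero]

theorem indicator_coeFn_add {p : ℝ≥0∞} (f g : Lp E p μ) :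
    s.indicator (f + g : Lp E p μ) =ᵐ[μ] s.indicator f + s.indicator g := by
  filter_upwards [Lp.coeFn_add f g] with a ha
  rw [Pi.add_apply]
  by_cases has : a ∈ s
  · rw [indicator_of_mem has, indicator_of_mem has, indicator_of_mem has, ha, Pi.add_apply]
  · rw [indicator_of_notMem has, indicator_of_notMem has, indicator_of_notMem has, add_zero]

/-- The `L^q` norm need not be continuous on `L²`, but it is lower semicontinuous: pass to an almost
everywhere convergent subsequence and use Fatou's lemma. -/
theorem isClosed_setOf_eLpNorm_indicator_le (hs : MeasurableSet s) (M : ℝ≥0∞) :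
    IsClosed {g : Lp E 2 μ | eLpNorm (s.indicator g) q μ ≤ M} := by
  rw [← isSeqClosed_iff_isClosed]
  intro f g hf hg
  obtain ⟨v, -, hv⟩ := (tendstoInMeasure_of_tendsto_Lp hg).exists_seq_tendsto_ae
  refine Lp.eLpNorm_le_of_ae_tendsto (u := atTop) (f := fun k => s.indicator (f (v k)))
    (Eventually.of_forall fun k => hf (v k))
    (fun k => (Lp.aestronglyMeasurable _).indicator hs) ?_
  filter_upwards [hv] with a ha
  by_cases has : a ∈ s
  · simpa [has] using ha
  · simp [has]

variable [NormedSpace ℝ E]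

theorem convex_setOf_eLpNorm_indicator_le (hs : MeasurableSet s) (hq : 1 ≤ q) (M : ℝ≥0∞) :
    Convex ℝ {g : Lp E 2 μ | eLpNorm (s.indicator g) q μ ≤ M} := by
  intro f hf g hg a b ha hb hab
  have h1 : s.indicator (a • f + b • g : Lp E 2 μ) =ᵐ[μ]
      a • s.indicator f + b • s.indicator g :=
    (indicator_coeFn_add _ _).trans ((indicator_coeFn_smul a f).add (indicator_coeFn_smul b g))
  have hm : ∀ h : Lp E 2 μ, AEStronglyMeasurable (s.indicator h) μ := fun h =>
    (Lp.aestronglyMeasurable h).indicator hs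
  change eLpNorm _ q μ ≤ M
  rw [eLpNorm_congr_ae h1]
  refine (eLpNorm_add_le ((hm f).const_smul a) ((hm g).const_smul b) hq).trans ?_
  rw [eLpNorm_const_smul, eLpNorm_const_smul, Real.enorm_eq_ofReal ha, Real.enorm_eq_ofReal hb]
  calc _ ≤ ENNReal.ofReal a * M + ENNReal.ofReal b * M := by gcongr <;> assumption
    _ = M := by rw [← add_mul, ← ENNReal.ofReal_add ha hb, hab]; simp

/-- Minkowski's integral inequality for `L²`-valued integrals and the `L^q` norm on a set. -/
theorem eLpNorm_indicator_integral_le [CompleteSpace E] (hs : MeasurableSet s) (hq : 1 ≤ q)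
    {F : X → Lp E 2 μ} {φ : X → ℝ} (hφ : Integrable φ ν) (hpos : ∀ᵐ x ∂ν, 0 < φ x)
    (hF : Integrable F ν)
    (h : ∀ᵐ x ∂ν, eLpNorm (s.indicator (F x)) q μ ≤ ENNReal.ofReal (φ x)) :
    eLpNorm (s.indicator (∫ x, F x ∂ν : Lp E 2 μ)) q μ ≤ ENNReal.ofReal (∫ x, φ x ∂ν) := by
  rcases eq_or_ne ν 0 with rfl | hν
  · rw [integral_zero_measure, eLpNorm_congr_ae (indicator_coeFn_zero 2), eLpNorm_zero]
    exact zero_le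
  set I := ∫ x, φ x ∂ν
  have hI : 0 < I := by
    rw [integral_pos_iff_support_of_nonneg_ae (hpos.mono fun _ hx => hx.le) hφ]
    refine pos_iff_ne_zero.2 fun h0 => hν ?_
    rw [← ae_eq_bot, ← eventually_false_iff_eq_bot]
    filter_upwards [hpos, measure_eq_zero_iff_ae_notMem.1 h0] with x hx hx'
    exact hx' hx.ne'
  have hm : AEMeasurable (fun x => ENNReal.ofReal (φ x / I)) ν :=
    (hφ.aemeasurable.div_const I).ennreal_ofReal
  have hlt : ∀ᵐ x ∂ν, ENNReal.ofReal (φ x / I) < ∞ :=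
    Eventually.of_forall fun _ => ENNReal.ofReal_lt_top
  -- With respect to the probability density `φ / I`, the integral of `F` is the mean of `(I / φ)
  -- F`. These functions lie in the closed convex set of elements with `L^q` norm on `s` at most
  -- `I`, hence so does the mean.
  set ν' := ν.withDensity fun x => ENNReal.ofReal (φ x / I)
  have hprob : IsProbabilityMeasure ν' := by
    constructor
    rw [withDensity_apply _ MeasurableSet.univ, Measure.restrict_univ,
      ← ofReal_integral_eq_lintegral_ofReal (hφ.div_const I)
        (hpos.mono fun _ hx => (div_pos hx hI).le), integral_div, div_self hI.ne',
      ENNReal.ofReal_one]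
  have hcancel : (fun x => (ENNReal.ofReal (φ x / I)).toReal • ((I / φ x) • F x)) =ᵐ[ν] F := by
    filter_upwards [hpos] with x hx
    rw [ENNReal.toReal_ofReal (div_pos hx hI).le, smul_smul]
    field_simp
    simp
  have hint : Integrable (fun x => (I / φ x) • F x) ν' := by
    rw [integrable_withDensity_iff_integrable_smul₀' hm hlt]
    exact hF.congr hcancel.symm
  have hmem := (convex_setOf_eLpNorm_indicator_le (μ := μ) (E := E) hs hq
    (ENNReal.ofReal I)).integral_mem (μ := ν') (f := fun x => (I / φ x) • F x)
    (isClosed_setOf_eLpNorm_indicator_le hs _) ?_ hint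
  · rw [integral_withDensity_eq_integral_toReal_smul₀ hm hlt, integral_congr_ae hcancel] at hmem
    exact hmem
  · refine (withDensity_absolutelyContinuous ν _).ae_le ?_
    filter_upwards [h, hpos] with x hx hxp
    have h1 : s.indicator ((I / φ x) • F x : Lp E 2 μ) =ᵐ[μ]
        (I / φ x) • s.indicator (F x) := indicator_coeFn_smul _ _
    change eLpNorm _ q μ ≤ _
    rw [eLpNorm_congr_ae h1, eLpNorm_const_smul, Real.enorm_eq_ofReal (div_pos hI hxp).le]
    calc _ ≤ ENNReal.ofReal (I / φ x) * ENNReal.ofReal (φ x) := by gcongr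
      _ = _ := by rw [← ENNReal.ofReal_mul (div_pos hI hxp).le, div_mul_cancel₀ _ hxp.ne']

end Minkowski

/-! ### Calculus of cutoffs and two-ball norms. -/

section Cutoff

variable {D n : ℕ} {Ω : Set (EuclideanSpace ℝ (Fin D))} {p q : ℝ≥0∞}
  {x y : EuclideanSpace ℝ (Fin D)} {r : ℝ}

/-- Multiplication by the characteristic function of a measurable set on `L²(Ω, ℂⁿ)`. -/
noncomputable def cutoff (A : Set (EuclideanSpace ℝ (Fin D))) (hA : MeasurableSet A)
    (f : LTwo Ω n) : LTwo Ω n :=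
  ((Lp.memLp f).indicator hA).toLp (A.indicator f)

theorem coeFn_cutoff {A : Set (EuclideanSpace ℝ (Fin D))} (hA : MeasurableSet A) (f : LTwo Ω n) :
    cutoff A hA f =ᵐ[volume.restrict Ω] A.indicator f :=
  MemLp.coeFn_toLp _

theorem coeFn_ballCutoff (f : LTwo Ω n) :
    ballCutoff x r f =ᵐ[volume.restrict Ω] (Metric.ball x r).indicator f :=
  MemLp.coeFn_toLp _

theorem eLpNorm_cutoff_le {A : Set (EuclideanSpace ℝ (Fin D))} (hA : MeasurableSet A)
    (f : LTwo Ω n) :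
    eLpNorm (cutoff A hA f) p (volume.restrict Ω) ≤ eLpNorm f p (volume.restrict Ω) := by
  rw [eLpNorm_congr_ae (coeFn_cutoff hA f)]
  exact eLpNorm_indicator_le _

theorem twoBallNorm_le_iff {T : LTwo Ω n →L[ℂ] LTwo Ω n} {M : ℝ≥0∞} :
    twoBallNorm p q T x y r ≤ M ↔ ∀ f : LTwo Ω n, eLpNorm f p (volume.restrict Ω) ≤ 1 →
      eLpNorm ((Metric.ball x r).indicator (T (ballCutoff y r f))) q (volume.restrict Ω) ≤ M := by
  simp only [twoBallNorm, iSup_le_iff]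
  refine forall₂_congr fun f _ => ?_
  rw [eLpNorm_congr_ae (coeFn_ballCutoff _)]

theorem twoBallNorm_smul_le (T : LTwo Ω n →L[ℂ] LTwo Ω n) (c : ℂ) :
    twoBallNorm p q (c • T) x y r ≤ ‖c‖ₑ * twoBallNorm p q T x y r := by
  rw [twoBallNorm_le_iff]
  intro f hf
  have h1 : (Metric.ball x r).indicator ((c • T) (ballCutoff y r f)) =ᵐ[volume.restrict Ω]
      c • (Metric.ball x r).indicator (T (ballCutoff y r f)) :=
    indicator_coeFn_smul _ _
  rw [eLpNorm_congr_ae h1, eLpNorm_const_smul]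
  gcongr
  exact twoBallNorm_le_iff.1 le_rfl f hf

theorem twoBallNorm_smul_le_ofReal {T : LTwo Ω n →L[ℂ] LTwo Ω n} {M : ℝ} (c : ℂ)
    (h : twoBallNorm p q T x y r ≤ ENNReal.ofReal M) :
    twoBallNorm p q (c • T) x y r ≤ ENNReal.ofReal (‖c‖ * M) := by
  refine (twoBallNorm_smul_le T c).trans ?_
  rw [ENNReal.ofReal_mul (norm_nonneg _), ofReal_norm]
  gcongr

theorem eLpNorm_indicator_apply_ballCutoff_le {T : LTwo Ω n →L[ℂ] LTwo Ω n} {M : ℝ≥0∞}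
    (hp : p ≠ 0)
    (h : twoBallNorm p q T x y r ≤ M) (f : LTwo Ω n)
    (hf : eLpNorm f p (volume.restrict Ω) ≠ ∞) :
    eLpNorm ((Metric.ball x r).indicator (T (ballCutoff y r f))) q (volume.restrict Ω) ≤
      M * eLpNorm f p (volume.restrict Ω) := by
  set N := eLpNorm f p (volume.restrict Ω) with hN
  rcases eq_or_ne N 0 with h0 | h0
  · have hf0 : f = 0 := by
      rw [hN, eLpNorm_eq_zero_iff (Lp.aestronglyMeasurable f) hp] at h0
      exact Lp.ext (h0.trans (Lp.coeFn_zero _ _ _).symm)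
    have hb : ballCutoff y r f = 0 := by
      rw [hf0]
      exact Lp.ext ((coeFn_ballCutoff _).trans
        ((indicator_coeFn_zero 2).trans (Lp.coeFn_zero _ _ _).symm))
    have hz : (Metric.ball x r).indicator (T (ballCutoff y r f)) =ᵐ[volume.restrict Ω] 0 := by
      rw [hb, map_zero]
      exact indicator_coeFn_zero 2
    rw [eLpNorm_congr_ae hz, eLpNorm_zero]
    exact zero_le
  · set c : ℝ := N.toReal with hc
    have hc0 : 0 < c := ENNReal.toReal_pos h0 hf
    have hcN : ENNReal.ofReal c = N := ENNReal.ofReal_toReal hf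
    have hnorm : eLpNorm ((c⁻¹ : ℂ) • f : LTwo Ω n) p (volume.restrict Ω) ≤ 1 := by
      rw [eLpNorm_congr_ae (Lp.coeFn_smul _ _), eLpNorm_const_smul, ← Complex.ofReal_inv,
        ← ofReal_norm, Complex.norm_real, Real.norm_of_nonneg (inv_pos.2 hc0).le,
        ENNReal.ofReal_inv_of_pos hc0, hcN, ← hN, ENNReal.inv_mul_cancel h0 hf]
    have h1 := twoBallNorm_le_iff.1 h _ hnorm
    have hcut : f = (c : ℂ) • ((c⁻¹ : ℂ) • f) := by
      rw [smul_smul, mul_inv_cancel₀ (by exact_mod_cast hc0.ne'), one_smul]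
    have hsm : ballCutoff y r f = (c : ℂ) • ballCutoff y r ((c⁻¹ : ℂ) • f) := by
      nth_rw 1 [hcut]
      refine Lp.ext ((coeFn_ballCutoff _).trans ((indicator_coeFn_smul _ _).trans ?_))
      exact ((coeFn_ballCutoff _).symm.const_smul _).trans (Lp.coeFn_smul _ _).symm
    have hT : (Metric.ball x r).indicator (T (ballCutoff y r f)) =ᵐ[volume.restrict Ω]
        (c : ℂ) • (Metric.ball x r).indicator (T (ballCutoff y r ((c⁻¹ : ℂ) • f))) := by
      rw [hsm, map_smul]
      exact indicator_coeFn_smul _ _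
    rw [eLpNorm_congr_ae hT, eLpNorm_const_smul, ← ofReal_norm, Complex.norm_real,
      Real.norm_of_nonneg hc0.le, hcN, mul_comm]
    gcongr

/-- The route by which bounds pass through operator-valued integrals; strong integrability, one `f`
at a time, is enough. -/
theorem twoBallNorm_le_integral {X : Type*} [MeasurableSpace X] {ν : Measure X} (hq : 1 ≤ q)
    {T : LTwo Ω n →L[ℂ] LTwo Ω n} {F : X → LTwo Ω n →L[ℂ] LTwo Ω n} {φ : X → ℝ}
    (hφ : Integrable φ ν) (hpos : ∀ᵐ τ ∂ν, 0 < φ τ)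
    (hF : ∀ f, Integrable (fun τ => F τ f) ν) (hT : ∀ f, T f = ∫ τ, F τ f ∂ν)
    (h : ∀ᵐ τ ∂ν, twoBallNorm p q (F τ) x y r ≤ ENNReal.ofReal (φ τ)) :
    twoBallNorm p q T x y r ≤ ENNReal.ofReal (∫ τ, φ τ ∂ν) := by
  rw [twoBallNorm_le_iff]
  intro f hf
  rw [hT]
  refine eLpNorm_indicator_integral_le measurableSet_ball hq hφ hpos (hF _) ?_
  filter_upwards [h] with τ hτ
  exact twoBallNorm_le_iff.1 hτ f hf

end Cutoff

/-! ### Block-diagonal operators. -/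

section Disjoint

variable {α E ι : Type*}

theorem apply_sum_indicator_of_pairwiseDisjoint {F M : Type*} [AddCommMonoid F]
    [AddCommMonoid M] {I : Finset ι}
    {B : ι → Set α} (hB : (I : Set ι).PairwiseDisjoint B) {Φ : F → M} (hΦ : Φ 0 = 0)
    (g : ι → α → F) (x : α) :
    Φ (∑ k ∈ I, (B k).indicator (g k) x) = ∑ k ∈ I, Φ ((B k).indicator (g k) x) := by
  by_cases h : ∃ j ∈ I, x ∈ B j
  · obtain ⟨j, hj, hx⟩ := h
    have hne : ∀ k ∈ I, k ≠ j → (B k).indicator (g k) x = 0 := fun k hk hkj =>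
      indicator_of_notMem (fun hxk => (hB hk hj hkj).le_bot ⟨hxk, hx⟩) _
    rw [Finset.sum_eq_single_of_mem j hj hne,
      Finset.sum_eq_single_of_mem j hj fun k hk hkj => by rw [hne k hk hkj, hΦ]]
  · push Not at h
    have h0 : ∀ k ∈ I, (B k).indicator (g k) x = 0 := fun k hk => indicator_of_notMem (h k hk) _
    rw [Finset.sum_eq_zero h0, hΦ, Finset.sum_eq_zero fun k hk => by rw [h0 k hk, hΦ]]

variable [MeasurableSpace α] {μ : Measure α} [NormedAddCommGroup E] {p q : ℝ≥0∞}

/-- A block-diagonal operator is bounded from `L^p` to `L^q`, `p ≤ q`, if its blocks are. -/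
theorem eLpNorm_sum_indicator_le (hp : 1 ≤ p) (hp' : p ≠ ∞) (hpq : p ≤ q) {I : Finset ι}
    {A B : ι → Set α} (hA : (I : Set ι).PairwiseDisjoint A) (hAm : ∀ k ∈ I, MeasurableSet (A k))
    (hB : (I : Set ι).PairwiseDisjoint B) (hBm : ∀ k ∈ I, MeasurableSet (B k))
    {f : α → E} (hfm : AEStronglyMeasurable f μ) (hf : eLpNorm f p μ ≤ 1)
    {g : ι → α → E} (hg : ∀ k ∈ I, AEStronglyMeasurable (g k) μ) {κ : ℝ≥0∞}
    (h : ∀ k ∈ I, eLpNorm ((B k).indicator (g k)) q μ ≤ κ * eLpNorm ((A k).indicator f) p μ) :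
    eLpNorm (fun x => ∑ k ∈ I, (B k).indicator (g k) x) q μ ≤ κ := by
  have hp0 : 0 < p := zero_lt_one.trans_le hp
  have hA1 : ∀ k, eLpNorm ((A k).indicator f) p μ ≤ 1 := fun k =>
    (eLpNorm_indicator_le _).trans hf
  rcases eq_or_ne q ∞ with rfl | hq'
  · rw [eLpNorm_exponent_top]
    have hall : ∀ᵐ x ∂μ, ∀ k ∈ I, ‖(B k).indicator (g k) x‖ₑ ≤ κ := by
      rw [Filter.eventually_all_finset]
      intro k hk
      have h1 := (h k hk).trans (mul_le_of_le_one_right zero_le (hA1 k))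
      rw [eLpNorm_exponent_top] at h1
      filter_upwards [enorm_ae_le_eLpNormEssSup ((B k).indicator (g k)) μ] with x hx
      exact hx.trans h1
    refine essSup_le_of_ae_le _ ?_
    filter_upwards [hall] with x hx
    by_cases hxB : ∃ j ∈ I, x ∈ B j
    · obtain ⟨j, hj, hxj⟩ := hxB
      rw [Finset.sum_eq_single_of_mem j hj fun k hk hkj =>
        indicator_of_notMem (fun hxk => (hB hk hj hkj).le_bot ⟨hxk, hxj⟩) _]
      exact hx j hj
    · push Not at hxB
      rw [Finset.sum_eq_zero fun k hk => indicator_of_notMem (hxB k hk) _]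
      simp
  · have hq0 : 0 < q := hp0.trans_le hpq
    have hqr : 0 < q.toReal := ENNReal.toReal_pos hq0.ne' hq'
    have hpr : 0 < p.toReal := ENNReal.toReal_pos hp0.ne' hp'
    have hpow : ∀ {r : ℝ≥0∞}, 0 < r → r ≠ ∞ → ∀ u : α → E,
        eLpNorm u r μ ^ r.toReal = ∫⁻ x, ‖u x‖ₑ ^ r.toReal ∂μ := by
      intro r hr0 hr u
      rw [eLpNorm_eq_eLpNorm' hr0.ne' hr,
        ← lintegral_rpow_enorm_eq_rpow_eLpNorm' (ENNReal.toReal_pos hr0.ne' hr)]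
    have hsplit : ∀ {r : ℝ≥0∞}, 0 < r → r ≠ ∞ → ∀ {S : ι → Set α} {u : ι → α → E},
        (I : Set ι).PairwiseDisjoint S → (∀ k ∈ I, MeasurableSet (S k)) →
        (∀ k ∈ I, AEStronglyMeasurable (u k) μ) →
        eLpNorm (fun x => ∑ k ∈ I, (S k).indicator (u k) x) r μ ^ r.toReal =
          ∑ k ∈ I, eLpNorm ((S k).indicator (u k)) r μ ^ r.toReal := by
      intro r hr0 hr S u hS hSm hu
      simp_rw [hpow hr0 hr]
      rw [← lintegral_finsetSum']
      · refine lintegral_congr fun x => ?_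
        exact apply_sum_indicator_of_pairwiseDisjoint hS (Φ := fun v : E => ‖v‖ₑ ^ r.toReal)
          (by simp [ENNReal.toReal_pos hr0.ne' hr]) u x
      · exact fun k hk => ((hu k hk).indicator (hSm k hk)).enorm.pow_const _
    rw [← ENNReal.rpow_le_rpow_iff hqr, hsplit hq0 hq' hB hBm hg]
    calc ∑ k ∈ I, eLpNorm ((B k).indicator (g k)) q μ ^ q.toReal
        ≤ ∑ k ∈ I, κ ^ q.toReal * eLpNorm ((A k).indicator f) p μ ^ p.toReal := by
          refine Finset.sum_le_sum fun k hk => ?_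
          refine (ENNReal.rpow_le_rpow (h k hk) hqr.le).trans ?_
          rw [ENNReal.mul_rpow_of_nonneg _ _ hqr.le]
          gcongr κ ^ _ * ?_
          -- The embedding of `ℓ^p` in `ℓ^q`: each piece of `f` has norm at most `1`, so raising the
          -- exponent from `p` to `q` only decreases its power.
          exact ENNReal.rpow_le_rpow_of_exponent_ge (hA1 k) (ENNReal.toReal_mono hq' hpq)
      _ = κ ^ q.toReal * eLpNorm (fun x => ∑ k ∈ I, (A k).indicator f x) p μ ^ p.toReal := by
          rw [← Finset.mul_sum, hsplit hp0 hp' (u := fun _ => f) hA hAm fun _ _ => hfm]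
      _ ≤ κ ^ q.toReal * 1 := by
          gcongr
          refine ENNReal.rpow_le_one ((eLpNorm_mono_enorm fun x => ?_).trans hf) hpr.le
          by_cases hxA : ∃ j ∈ I, x ∈ A j
          · obtain ⟨j, hj, hxj⟩ := hxA
            rw [Finset.sum_eq_single_of_mem j hj fun k hk hkj =>
              indicator_of_notMem (fun hxk => (hA hk hj hkj).le_bot ⟨hxk, hxj⟩) _,
              indicator_of_mem hxj]
          · push Not at hxA
            rw [Finset.sum_eq_zero fun k hk => indicator_of_notMem (hxA k hk) _]
            simp
      _ = _ := mul_one _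

end Disjoint

/-! ### The grid of cubes and its lattice sum. -/

section Cubes

variable {D : ℕ}

/-- The index of the cube of the grid of mesh `h` that contains `z`. -/
noncomputable def cubeIndex (h : ℝ) (z : EuclideanSpace ℝ (Fin D)) : Fin D → ℤ :=
  fun i => ⌊z i / h⌋

/-- The half-open cube with index `k` of the grid of mesh `h`. -/
def cube (h : ℝ) (k : Fin D → ℤ) : Set (EuclideanSpace ℝ (Fin D)) := {z | cubeIndex h z = k}

theorem measurableSet_cube (h : ℝ) (k : Fin D → ℤ) : MeasurableSet (cube h k) := by
  have : Measurable (cubeIndex (D := D) h) := by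
    refine measurable_pi_lambda _ fun i => Int.measurable_floor.comp ?_
    fun_prop
  exact this (measurableSet_singleton k)

theorem pairwise_disjoint_cube (h : ℝ) : Pairwise (Function.onFun Disjoint (cube (D := D) h)) :=
  fun _ _ hkl => Set.disjoint_left.2 fun _ hz hz' => hkl (hz.symm.trans hz')

/-- The diameter is at most `√D` times the mesh and `√D < D + 1`; thus a ball of radius `s` centred
anywhere in a cube contains the whole cube. The divisor `D + 1` also avoids division by zero when `D
= 0`. -/
theorem norm_sub_lt_of_mem_cube {s : ℝ} (hs : 0 < s) {k : Fin D → ℤ}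
    {z w : EuclideanSpace ℝ (Fin D)} (hz : z ∈ cube (s / (D + 1)) k)
    (hw : w ∈ cube (s / (D + 1)) k) : ‖z - w‖ < s := by
  have hh : 0 < s / (D + 1) := by positivity
  set h := s / (D + 1) with hh'
  refine lt_of_pow_lt_pow_left₀ 2 hs.le ?_
  rw [EuclideanSpace.real_norm_sq_eq]
  have hi : ∀ i, (z - w) i ^ 2 ≤ h ^ 2 := by
    intro i
    have h1 : ⌊z i / h⌋ = k i := congrFun hz i
    have h2 : ⌊w i / h⌋ = k i := congrFun hw i
    have h3 := Int.abs_sub_lt_one_of_floor_eq_floor (h1.trans h2.symm)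
    rw [← sub_div, abs_div, abs_of_pos hh, div_lt_one hh] at h3
    rw [PiLp.sub_apply, ← sq_abs]
    gcongr
  calc ∑ i, (z - w) i ^ 2 ≤ ∑ _i : Fin D, h ^ 2 := Finset.sum_le_sum fun i _ => hi i
    _ = D * h ^ 2 := by simp
    _ < (D + 1) ^ 2 * h ^ 2 := by
        have : (0 : ℝ) ≤ D := D.cast_nonneg
        gcongr
        nlinarith
    _ = s ^ 2 := by rw [hh']; field_simp

/-- Points in cubes whose indices differ by `l i` can be closer than `|l i|` meshes, but by at most
one mesh. Summing over coordinates, instead of taking a maximum, lets the exponential weight factor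
in `sum_exp_neg_le_gridConst`. -/
theorem sum_abs_sub_one_le {s : ℝ} (hs : 0 < s) {k l : Fin D → ℤ}
    {z w : EuclideanSpace ℝ (Fin D)} (hz : z ∈ cube (s / (D + 1)) (k + l))
    (hw : w ∈ cube (s / (D + 1)) k) :
    ∑ i, (|(l i : ℝ)| - 1) ≤ (D + 1) ^ 2 * (‖z - w‖ / s) := by
  have hh : 0 < s / (D + 1) := by positivity
  have hi : ∀ i ∈ Finset.univ, |(l i : ℝ)| - 1 ≤ ‖z - w‖ / (s / (D + 1)) := by
    intro i _
    have h1 : ⌊z i / (s / (D + 1))⌋ = k i + l i := congrFun hz i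
    have h2 : ⌊w i / (s / (D + 1))⌋ = k i := congrFun hw i
    rw [Int.floor_eq_iff] at h1 h2
    push_cast at h1
    have h3 : |(z - w) i| ≤ ‖z - w‖ := PiLp.norm_apply_le (z - w) i
    have h4 : |(z i - w i) / (s / (D + 1))| ≤ ‖z - w‖ / (s / (D + 1)) := by
      rw [abs_div, abs_of_pos hh]
      gcongr
      exact h3
    rw [sub_div] at h4
    have h5 := abs_le.1 h4
    have h6 : |(l i : ℝ)| ≤ ‖z - w‖ / (s / (D + 1)) + 1 := abs_le.2 ⟨by linarith, by linarith⟩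
    linarith
  have h7 : ∑ i, (|(l i : ℝ)| - 1) ≤ D * (‖z - w‖ / (s / (D + 1))) := by
    simpa using Finset.sum_le_card_nsmul _ _ _ hi
  calc _ ≤ D * (‖z - w‖ / (s / (D + 1))) := h7
    _ ≤ (D + 1) * (‖z - w‖ / (s / (D + 1))) := by gcongr; linarith
    _ = _ := by field_simp

theorem abs_cubeIndex_le {h M : ℝ} (hh : 0 < h) {z : EuclideanSpace ℝ (Fin D)} (hz : ‖z‖ ≤ M)
    (i : Fin D) : |cubeIndex h z i| ≤ ⌈M / h⌉ + 1 := by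
  have h1 : |z i / h| ≤ M / h := by
    rw [abs_div, abs_of_pos hh]
    gcongr
    exact (PiLp.norm_apply_le z i).trans hz
  have h2 := abs_le.1 h1
  have h3 := Int.le_ceil (M / h)
  have h4 := Int.floor_le (z i / h)
  have h5 := Int.lt_floor_add_one (z i / h)
  have h6 : (|⌊z i / h⌋| : ℝ) ≤ ⌈M / h⌉ + 1 := abs_le.2 ⟨by linarith, by linarith⟩
  exact_mod_cast h6

/-- The sum over the lattice `ℤ^D` of the exponential weights that control shifts of the grid. -/
noncomputable def gridConst (D : ℕ) (β : ℝ) : ℝ :=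
  (∑' j : ℤ, Real.exp (-(β / (D + 1) ^ 2 * (|(j : ℝ)| - 1)))) ^ D

theorem summable_exp_neg_abs {γ : ℝ} (hγ : 0 < γ) :
    Summable fun j : ℤ => Real.exp (-(γ * (|(j : ℝ)| - 1))) := by
  have h : Summable fun j : ℕ => Real.exp (-(γ * ((j : ℝ) - 1))) := by
    have := (Real.summable_exp_nat_mul_iff.2 (neg_lt_zero.2 hγ)).mul_left (Real.exp γ)
    refine this.congr fun j => ?_
    rw [← Real.exp_add]
    congr 1
    ring
  exact Summable.of_nat_of_neg (by simpa using h) (by simpa using h)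

theorem gridConst_pos (D : ℕ) {β : ℝ} (hβ : 0 < β) : 0 < gridConst D β :=
  pow_pos ((summable_exp_neg_abs (by positivity)).tsum_pos (fun _ => (Real.exp_pos _).le) 0
    (Real.exp_pos _)) D

/-- The weight is a product over coordinates, so the sum over a box is the `D`-th power of a
one-dimensional sum. The bound does not depend on `J`, hence not on the number of cubes. -/
theorem sum_exp_neg_le_gridConst {β : ℝ} (hβ : 0 < β) (J : Finset ℤ) :
    ∑ l ∈ Fintype.piFinset fun _ : Fin D => J,
      Real.exp (-(β / (D + 1) ^ 2 * ∑ i, (|(l i : ℝ)| - 1))) ≤ gridConst D β := by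
  have h1 : ∀ l : Fin D → ℤ, Real.exp (-(β / (D + 1) ^ 2 * ∑ i, (|(l i : ℝ)| - 1))) =
      ∏ i, Real.exp (-(β / (D + 1) ^ 2 * (|(l i : ℝ)| - 1))) := by
    intro l
    rw [← Real.exp_sum, Finset.mul_sum, Finset.sum_neg_distrib]
  simp_rw [h1]
  rw [← Finset.prod_univ_sum (fun _ => J)
    fun _ (j : ℤ) => Real.exp (-(β / (D + 1) ^ 2 * (|(j : ℝ)| - 1)))]
  rw [Finset.prod_const, Finset.card_univ, Fintype.card_fin, gridConst]
  have hs := summable_exp_neg_abs (γ := β / (D + 1) ^ 2) (by positivity)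
  gcongr
  exact hs.sum_le_tsum _ fun _ _ => (Real.exp_pos _).le

end Cubes

/-! ### Change of radius in two-ball bounds. -/

section Scale

variable {D n : ℕ} {Ω : Set (EuclideanSpace ℝ (Fin D))} {p q : ℝ≥0∞}

theorem sum_cutoff_cube_eq {h : ℝ} {J : Finset (Fin D → ℤ)} {S : Set (EuclideanSpace ℝ (Fin D))}
    (hJ : ∀ z ∈ S, cubeIndex h z ∈ J) {f : LTwo Ω n}
    (hf : ∀ᵐ a ∂(volume.restrict Ω), a ∉ S → f a = 0) :
    ∑ k ∈ J, cutoff (cube h k) (measurableSet_cube h k) f = f := by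
  apply Lp.ext
  have hall : ∀ᵐ a ∂(volume.restrict Ω), ∀ k ∈ J,
      cutoff (cube h k) (measurableSet_cube h k) f a = (cube h k).indicator f a := by
    rw [Filter.eventually_all_finset]
    exact fun k _ => coeFn_cutoff (measurableSet_cube h k) f
  filter_upwards [Lp.coeFn_fun_finsetSum J fun k => cutoff (cube h k) (measurableSet_cube h k) f,
    hall, hf] with a h1 h2 h3
  rw [h1, Finset.sum_congr rfl h2]
  by_cases ha : a ∈ S
  · have hne : ∀ k ∈ J, k ≠ cubeIndex h a → (cube h k).indicator f a = 0 := fun k _ hk =>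
      indicator_of_notMem (fun hak : a ∈ cube h k => hk (Eq.symm hak)) _
    rw [Finset.sum_eq_single_of_mem _ (hJ a ha) hne]
    exact indicator_of_mem (show a ∈ cube h (cubeIndex h a) from rfl) _
  · rw [h3 ha]
    refine Finset.sum_eq_zero fun k _ => ?_
    by_cases hak : a ∈ cube h k
    · rw [indicator_of_mem hak, h3 ha]
    · exact indicator_of_notMem hak _

/-- The bound for one pair of cubes, by balls centred in them. -/
theorem eLpNorm_indicator_cube_le (hΩ : MeasurableSet Ω) (hp : 1 ≤ p) {s : ℝ} (hs : 0 < s)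
    {T : LTwo Ω n →L[ℂ] LTwo Ω n} {U V : Set (EuclideanSpace ℝ (Fin D))} {k j : Fin D → ℤ} {M : ℝ≥0∞}
    (h : ∀ x' ∈ Ω ∩ U ∩ cube (s / (D + 1)) j, ∀ y' ∈ Ω ∩ V ∩ cube (s / (D + 1)) k,
      twoBallNorm p q T x' y' s ≤ M) {f : LTwo Ω n}
    (hf : ∀ᵐ a ∂(volume.restrict Ω), a ∉ V → f a = 0)
    (hfp : eLpNorm f p (volume.restrict Ω) ≠ ∞) :
    eLpNorm ((cube (s / (D + 1)) j ∩ U).indicator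
        (T (cutoff (cube (s / (D + 1)) k) (measurableSet_cube _ k) f))) q (volume.restrict Ω) ≤
      M * eLpNorm ((cube (s / (D + 1)) k).indicator f) p (volume.restrict Ω) := by
  set Qk := cube (s / (D + 1)) k
  set Qj := cube (s / (D + 1)) j
  set g := cutoff Qk (measurableSet_cube _ k) f
  have hg : g =ᵐ[volume.restrict Ω] Qk.indicator f := coeFn_cutoff _ f
  -- Bounds are known only for centres in `Ω` and in the prescribed sets. If a cube contains no such
  -- centre, the corresponding block vanishes almost everywhere.
  rcases (Ω ∩ V ∩ Qk).eq_empty_or_nonempty with he | ⟨y', hy'⟩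
  · have hg0 : g = 0 := by
      apply Lp.ext
      filter_upwards [hg, hf, ae_restrict_mem hΩ,
        Lp.coeFn_zero (EuclideanSpace ℂ (Fin n)) 2 (volume.restrict Ω)] with a h1 h2 h3 h4
      rw [h1, h4]
      by_cases ha : a ∈ Qk
      · rw [indicator_of_mem ha]
        refine h2 fun hV => ?_
        have : a ∈ Ω ∩ V ∩ Qk := ⟨⟨h3, hV⟩, ha⟩
        rw [he] at this
        exact this
      · rw [indicator_of_notMem ha]; rfl
    rw [hg0, map_zero, eLpNorm_congr_ae (indicator_coeFn_zero 2), eLpNorm_zero]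
    exact zero_le
  rcases (Ω ∩ U ∩ Qj).eq_empty_or_nonempty with he | ⟨x', hx'⟩
  · have h0 : (Qj ∩ U).indicator (T g) =ᵐ[volume.restrict Ω] 0 := by
      filter_upwards [ae_restrict_mem hΩ] with a ha
      refine indicator_of_notMem (fun h1 => ?_) _
      have : a ∈ Ω ∩ U ∩ Qj := ⟨⟨ha, h1.2⟩, h1.1⟩
      rw [he] at this
      exact this
    rw [eLpNorm_congr_ae h0, eLpNorm_zero]
    exact zero_le
  have hball : ∀ {i : Fin D → ℤ} {z w : EuclideanSpace ℝ (Fin D)},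
      z ∈ cube (s / (D + 1)) i → w ∈ cube (s / (D + 1)) i → z ∈ Metric.ball w s :=
    fun hz hw => by
      rw [Metric.mem_ball, dist_eq_norm]
      exact norm_sub_lt_of_mem_cube hs hz hw
  have hcut : ballCutoff y' s g = g := by
    apply Lp.ext
    filter_upwards [coeFn_ballCutoff (x := y') (r := s) g, hg] with a h1 h2
    rw [h1]
    by_cases ha : a ∈ Metric.ball y' s
    · rw [indicator_of_mem ha]
    · rw [indicator_of_notMem ha, h2, indicator_of_notMem fun hak => ha (hball hak hy'.2)]
  have hgp : eLpNorm g p (volume.restrict Ω) ≠ ∞ :=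
    ((eLpNorm_cutoff_le _ f).trans_lt hfp.lt_top).ne
  have h1 := eLpNorm_indicator_apply_ballCutoff_le (zero_lt_one.trans_le hp).ne'
    (h x' hx' y' hy') g hgp
  rw [hcut, eLpNorm_congr_ae hg] at h1
  refine (eLpNorm_mono fun a => ?_).trans h1
  exact norm_indicator_le_of_subset (fun z hz => hball hz.1 hx'.2) _ _

/-- No relation between `r` and `s` is required: cubes are matched to `s`, and the decay in `‖x' -
y'‖ / s` pays for the number of cubes in the balls. Centres range only over the two balls of radius
`r`, so any decay in the distance of these balls can be placed in `A`. -/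
theorem twoBallNorm_le_of_small_scale (hΩ : MeasurableSet Ω) (hp : 1 ≤ p) (hp' : p ≠ ∞)
    (hpq : p ≤ q) {s : ℝ} (hs : 0 < s) {A β : ℝ} (hA : 0 ≤ A) (hβ : 0 < β)
    {T : LTwo Ω n →L[ℂ] LTwo Ω n} {x y : EuclideanSpace ℝ (Fin D)} {r : ℝ}
    (h : ∀ x' ∈ Ω ∩ Metric.ball x r, ∀ y' ∈ Ω ∩ Metric.ball y r,
      twoBallNorm p q T x' y' s ≤ ENNReal.ofReal (A * Real.exp (-(β * (‖x' - y'‖ / s))))) :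
    twoBallNorm p q T x y r ≤ ENNReal.ofReal (gridConst D β * A) := by
  rw [twoBallNorm_le_iff]
  intro f₀ hf₀
  set f := ballCutoff y r f₀ with hfdef
  set h' : ℝ := s / (D + 1) with hh'
  have hh : 0 < h' := by positivity
  have hf1 : eLpNorm f p (volume.restrict Ω) ≤ 1 :=
    (eLpNorm_cutoff_le measurableSet_ball f₀).trans hf₀
  have hfs : ∀ᵐ a ∂(volume.restrict Ω), a ∉ Metric.ball y r → f a = 0 := by
    filter_upwards [coeFn_ballCutoff (x := y) (r := r) f₀] with a h1 h2
    rw [hfdef, h1, indicator_of_notMem h2]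
  set M : ℝ := max (‖x‖ + r) (‖y‖ + r)
  set N : ℤ := ⌈M / h'⌉ + 1
  -- Both balls are bounded, so finitely many cubes suffice: `J` contains the indices of all cubes
  -- that meet either ball, and `J2` all differences of elements of `J`.
  set J : Finset (Fin D → ℤ) := Fintype.piFinset fun _ => Finset.Icc (-N) N with hJdef
  set J2 : Finset (Fin D → ℤ) := Fintype.piFinset fun _ => Finset.Icc (-(2 * N)) (2 * N) with hJ2
  have hJmem : ∀ z : EuclideanSpace ℝ (Fin D), ‖z‖ ≤ M → cubeIndex h' z ∈ J := by
    intro z hz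
    rw [hJdef, Fintype.mem_piFinset]
    intro i
    rw [Finset.mem_Icc]
    exact abs_le.1 (abs_cubeIndex_le hh hz i)
  have hnorm : ∀ {c z : EuclideanSpace ℝ (Fin D)}, z ∈ Metric.ball c r → ‖z‖ ≤ ‖c‖ + r := by
    intro c z hz
    rw [Metric.mem_ball, dist_eq_norm] at hz
    calc ‖z‖ = ‖c + (z - c)‖ := by rw [add_sub_cancel]
      _ ≤ ‖c‖ + ‖z - c‖ := norm_add_le _ _
      _ ≤ _ := by linarith
  have hJx : ∀ z ∈ Metric.ball x r, cubeIndex h' z ∈ J := fun z hz =>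
    hJmem z ((hnorm hz).trans (le_max_left _ _))
  have hJy : ∀ z ∈ Metric.ball y r, cubeIndex h' z ∈ J := fun z hz =>
    hJmem z ((hnorm hz).trans (le_max_right _ _))
  set F : (Fin D → ℤ) → LTwo Ω n := fun k =>
    T (cutoff (cube h' k) (measurableSet_cube h' k) f) with hF
  -- The block matrix is summed along its diagonals: `k` is the input cube, `k + l` the output cube,
  -- and the outer sum runs over the shift `l`.
  have hdecomp : (Metric.ball x r).indicator (T f) =ᵐ[volume.restrict Ω]
      ∑ l ∈ J2, fun a => ∑ k ∈ J, (cube h' (k + l) ∩ Metric.ball x r).indicator (F k) a := by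
    have hTf : T f = ∑ k ∈ J, F k := by
      rw [hF, ← map_sum, sum_cutoff_cube_eq hJy hfs]
    rw [hTf]
    filter_upwards [Lp.coeFn_fun_finsetSum J F] with a ha
    rw [Finset.sum_apply, Finset.sum_comm]
    by_cases hax : a ∈ Metric.ball x r
    · rw [indicator_of_mem hax, ha]
      refine Finset.sum_congr rfl fun k hk => ?_
      have hmem : cubeIndex h' a - k ∈ J2 := by
        have h1 := hJx a hax
        rw [hJdef, Fintype.mem_piFinset] at h1 hk
        rw [hJ2, Fintype.mem_piFinset]
        intro i
        have h2 := Finset.mem_Icc.1 (h1 i)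
        have h3 := Finset.mem_Icc.1 (hk i)
        rw [Finset.mem_Icc, Pi.sub_apply]
        constructor <;> linarith
      rw [Finset.sum_eq_single_of_mem _ hmem]
      · have hcube : a ∈ cube h' (k + (cubeIndex h' a - k)) := by
          change cubeIndex h' a = k + (cubeIndex h' a - k)
          abel
        exact (indicator_of_mem (mem_inter hcube hax) _).symm
      · intro l _ hl
        refine indicator_of_notMem (fun hal => hl ?_) _
        have h1 : cubeIndex h' a = k + l := hal.1
        rw [h1]
        abel
    · rw [indicator_of_notMem hax]
      refine (Finset.sum_eq_zero fun k _ => Finset.sum_eq_zero fun l _ => ?_).symm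
      exact indicator_of_notMem (fun hal => hax hal.2) _
  have hBm : ∀ k, MeasurableSet (cube h' k ∩ Metric.ball x r) := fun k =>
    (measurableSet_cube h' k).inter measurableSet_ball
  rw [eLpNorm_congr_ae hdecomp]
  refine (eLpNorm_sum_le (fun l _ => Finset.aestronglyMeasurable_fun_sum _ fun k _ =>
    (Lp.aestronglyMeasurable (F k)).indicator (hBm _)) (hp.trans hpq)).trans ?_
  set w : (Fin D → ℤ) → ℝ := fun l => Real.exp (-(β / (D + 1) ^ 2 * ∑ i, (|(l i : ℝ)| - 1)))
  have hpiece : ∀ l ∈ J2, eLpNorm (fun a => ∑ k ∈ J,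
      (cube h' (k + l) ∩ Metric.ball x r).indicator (F k) a) q (volume.restrict Ω) ≤
      ENNReal.ofReal (A * w l) := by
    intro l _
    refine eLpNorm_sum_indicator_le hp hp' hpq (A := cube h')
      (fun k _ k' _ hkk => pairwise_disjoint_cube h' hkk) (fun k _ => measurableSet_cube h' k)
      (fun k _ k' _ hkk => ?_) (fun k _ => hBm _) (Lp.aestronglyMeasurable f) hf1
      (fun k _ => Lp.aestronglyMeasurable (F k)) fun k _ => ?_
    · exact (pairwise_disjoint_cube h' fun he => hkk (add_right_cancel he)).mono
        inter_subset_left inter_subset_left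
    · refine eLpNorm_indicator_cube_le hΩ hp hs (V := Metric.ball y r) ?_ hfs
        (hf1.trans_lt ENNReal.one_lt_top).ne
      intro x' hx' y' hy'
      refine (h x' hx'.1 y' hy'.1).trans (ENNReal.ofReal_le_ofReal ?_)
      have h1 := sum_abs_sub_one_le hs hx'.2 hy'.2
      have h2 : β / (D + 1) ^ 2 * ∑ i, (|(l i : ℝ)| - 1) ≤ β * (‖x' - y'‖ / s) := by
        calc _ ≤ β / (D + 1) ^ 2 * ((D + 1) ^ 2 * (‖x' - y'‖ / s)) := by gcongr
          _ = _ := by field_simp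
      exact mul_le_mul_of_nonneg_left (Real.exp_le_exp.2 (neg_le_neg h2)) hA
  refine (Finset.sum_le_sum hpiece).trans ?_
  rw [← ENNReal.ofReal_sum_of_nonneg fun l _ => mul_nonneg hA (Real.exp_pos _).le,
    ← Finset.mul_sum, mul_comm]
  exact ENNReal.ofReal_le_ofReal
    (mul_le_mul_of_nonneg_right (sum_exp_neg_le_gridConst hβ _) hA)

end Scale

/-! ### From semigroup bounds to resolvent bounds. -/

section SemigroupToResolvent

theorem le_rpow_add_one {u μ : ℝ} (hu : 0 ≤ u) (hμ : 1 ≤ μ) : u ≤ u ^ μ + 1 := by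
  rcases le_total 1 u with h | h
  · have := Real.rpow_le_rpow_of_exponent_le h hμ
    rw [Real.rpow_one] at this
    linarith
  · have := Real.rpow_nonneg hu μ
    linarith

theorem one_le_conjExponent {m : ℝ} (hm : 2 ≤ m) : 1 ≤ m / (m - 1) := by
  rw [le_div_iff₀ (by linarith)]; linarith

/-- Young's inequality for `(ρt)^{1/m}` and `v` with the conjugate exponents `m` and `m/(m-1)`,
dropping the factors `1/m` and `(m-1)/m`. -/
theorem rpow_mul_le_add_rpow {m ρ t v : ℝ} (hm : 2 ≤ m) (hρ : 0 ≤ ρ) (ht : 0 ≤ t) (hv : 0 ≤ v) :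
    ρ ^ (1 / m) * (t ^ (1 / m) * v) ≤ ρ * t + v ^ (m / (m - 1)) := by
  have hm0 : 0 < m := by linarith
  have hconj : m.HolderConjugate (m / (m - 1)) := Real.HolderConjugate.conjExponent (by linarith)
  have h := Real.young_inequality_of_nonneg (Real.rpow_nonneg (mul_nonneg hρ ht) (1 / m)) hv hconj
  rw [← Real.rpow_mul (mul_nonneg hρ ht), one_div_mul_cancel hm0.ne', Real.rpow_one,
    Real.mul_rpow hρ ht, mul_assoc] at h
  refine h.trans (add_le_add ?_ ?_)
  · exact div_le_self (mul_nonneg hρ ht) (by linarith)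
  · exact div_le_self (Real.rpow_nonneg hv _) (one_le_conjExponent hm)

theorem max_norm_sub_le_of_mem_ball {V : Type*} [SeminormedAddCommGroup V] {x y x' y' : V} {r : ℝ}
    (hx : x' ∈ Metric.ball x r) (hy : y' ∈ Metric.ball y r) :
    max (‖x - y‖ - 2 * r) 0 ≤ ‖x' - y'‖ := by
  refine max_le ?_ (norm_nonneg _)
  rw [← dist_eq_norm, ← dist_eq_norm]
  have h1 := dist_triangle4 x x' y' y
  rw [Metric.mem_ball, dist_comm] at hx
  rw [Metric.mem_ball] at hy
  linarith

variable {D n : ℕ} {Ω : Set (EuclideanSpace ℝ (Fin D))} {p q : ℝ≥0∞}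

/-- Two-ball bounds for `e^{-tL}` on balls of a radius that is unrelated to `t`. -/
theorem twoBallNorm_semigroup_le_of_radius (hΩ : MeasurableSet Ω) (hp : 1 ≤ p) (hp' : p ≠ ∞)
    (hpq : p ≤ q) {L : LTwo Ω n →ₗ.[ℂ] LTwo Ω n} {m : ℝ} (hm : 2 ≤ m) {α b C : ℝ} (hb : 0 < b)
    (hC : 0 < C)
    (h : ∀ t : ℝ, 0 < t → ∀ x ∈ Ω, ∀ y ∈ Ω,
      twoBallNorm p q (semigroup L t) x y (t ^ (1 / m)) ≤
        ENNReal.ofReal (C * t ^ (-α) *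
          Real.exp (-(b * (‖x - y‖ / t ^ (1 / m)) ^ (m / (m - 1))))))
    {r t : ℝ} (ht : 0 < t) {x y : EuclideanSpace ℝ (Fin D)} :
    twoBallNorm p q (semigroup L t) x y r ≤
      ENNReal.ofReal (C * (gridConst D (b / 2) * Real.exp (b / 2)) * t ^ (-α) *
        Real.exp (-(b / 2 * (max (‖x - y‖ - 2 * r) 0 / t ^ (1 / m)) ^ (m / (m - 1))))) := by
  set s := t ^ (1 / m) with hs'
  have hs : 0 < s := Real.rpow_pos_of_pos ht _
  set μ := m / (m - 1)
  have hμ : 1 ≤ μ := one_le_conjExponent hm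
  set d := max (‖x - y‖ - 2 * r) 0
  have hd : 0 ≤ d := le_max_right _ _
  have htα : 0 < t ^ (-α) := Real.rpow_pos_of_pos ht _
  have hA : 0 ≤ C * t ^ (-α) * Real.exp (b / 2) * Real.exp (-(b / 2 * (d / s) ^ μ)) := by
    positivity
  refine (twoBallNorm_le_of_small_scale hΩ hp hp' hpq hs hA (half_pos hb) ?_).trans ?_
  · intro x' hx' y' hy'
    refine (h t ht x' hx'.1 y' hy'.1).trans (ENNReal.ofReal_le_ofReal ?_)
    have hdist := max_norm_sub_le_of_mem_ball hx'.2 hy'.2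
    rw [mul_assoc, mul_assoc, mul_assoc, mul_assoc, ← Real.exp_add, ← Real.exp_add]
    gcongr
    have h1 : (d / s) ^ μ ≤ (‖x' - y'‖ / s) ^ μ := by gcongr
    -- Half of the Gaussian exponent is kept for the distance `d`; the other half is weakened to
    -- linear decay, as the change of scale requires, at the cost of `e^{b/2}`.
    have h2 := le_rpow_add_one (div_nonneg (norm_nonneg (x' - y')) hs.le) hμ
    nlinarith
  · refine ENNReal.ofReal_le_ofReal (le_of_eq ?_)
    ring

theorem norm_mul_cos_le_re {z : ℂ} {θ : ℝ} (hθ : θ ≤ Real.pi) (hz : |z.arg| < θ) :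
    ‖z‖ * Real.cos θ ≤ z.re := by
  rw [← Complex.norm_mul_cos_arg z, ← Real.cos_abs z.arg]
  gcongr
  exact Real.cos_le_cos_of_nonneg_of_le_pi (abs_nonneg _) hθ hz.le

theorem resolventBounds_of_semigroupBounds (hΩ : MeasurableSet Ω)
    {L : LTwo Ω n →ₗ.[ℂ] LTwo Ω n} (hL : IsSelfAdjoint L) (hL0 : NonNegative L)
    (hp : 1 ≤ p) (hp' : p ≠ ∞) (hpq : p ≤ q) {m : ℝ} (hm : 2 ≤ m)
    (hD : smoothingExp D m p q < 1) (h : SemigroupBounds L m p q) {θ : ℝ}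
    (hθ : θ ∈ Ioo 0 (Real.pi / 2)) : ResolventBounds L m p q θ := by
  obtain ⟨b, C, hb, hC, h⟩ := h
  set α := smoothingExp D m p q
  have hα : 0 < 1 - α := by linarith
  set c := Real.cos θ
  have hc : 0 < c := Real.cos_pos_of_mem_Ioo ⟨by linarith [hθ.1, Real.pi_pos], hθ.2⟩
  set C₁ := C * (gridConst D (b / 2) * Real.exp (b / 2))
  have hC₁ : 0 < C₁ := mul_pos hC (mul_pos (gridConst_pos D (half_pos hb)) (Real.exp_pos _))
  -- Young's inequality consumes half of the decay `e^{-ρct}` and the Gaussian exponent `b/2`; the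
  -- remaining `e^{-ρct/2}` makes the Gamma integral converge at infinity.
  set β := min (c / 2) (b / 2)
  have hβ : 0 < β := lt_min (half_pos hc) (half_pos hb)
  have hΓ : 0 < Real.Gamma (1 - α) := Real.Gamma_pos_of_pos hα
  refine ⟨β, C₁ * ((2 / c) ^ (1 - α) * Real.Gamma (1 - α)) * Real.exp (2 * β), hβ, by positivity,
    fun x hx y hy z hz0 hz => ?_⟩
  set ρ := ‖z‖ with hρdef
  have hρ : 0 < ρ := norm_pos_iff.2 hz0
  have hre : ρ * c ≤ z.re := norm_mul_cos_le_re (by linarith [hθ.2, Real.pi_pos]) hz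
  have hrepos : 0 < z.re := (mul_pos hρ hc).trans_le hre
  set r := ρ ^ (-(1 / m)) with hr'
  have hr : 0 < r := Real.rpow_pos_of_pos hρ _
  set d := max (‖x - y‖ - 2 * r) 0
  have hd : 0 ≤ d := le_max_right _ _
  set K := C₁ * Real.exp (-(β * (ρ ^ (1 / m) * d)))
  have hK : 0 < K := by positivity
  set φ : ℝ → ℝ := fun t => K * (t ^ ((1 - α) - 1) * Real.exp (-(ρ * c / 2 * t)))
  have hval := Real.integral_rpow_mul_exp_neg_mul_Ioi hα (show 0 < ρ * c / 2 by positivity)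
  -- Integrability is read off from the value of the integral: a non-integrable function would have
  -- integral `0`.
  have hφ : IntegrableOn φ (Ioi 0) :=
    Integrable.const_mul (.of_integral_ne_zero (by rw [hval]; positivity)) K
  have hmain : twoBallNorm p q (shiftInv L z) x y r ≤
      ENNReal.ofReal (∫ t in Ioi (0 : ℝ), φ t) := by
    refine twoBallNorm_le_integral (hp.trans hpq)
      (F := fun t : ℝ => Complex.exp (-(z * t)) • semigroup L t) hφ ?_
      (fun f => integrableOn_exp_smul_semigroup hL hL0 f hrepos)
      (fun f => (integral_exp_smul_semigroup hL hL0 f hrepos).symm) ?_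
    · filter_upwards [ae_restrict_mem measurableSet_Ioi] with t ht
      have : 0 < t ^ ((1 - α) - 1) := Real.rpow_pos_of_pos ht _
      positivity
    · filter_upwards [ae_restrict_mem measurableSet_Ioi] with t ht
      have ht' : 0 < t := ht
      refine (twoBallNorm_smul_le_ofReal _ (twoBallNorm_semigroup_le_of_radius hΩ hp hp' hpq hm hb
        hC h ht)).trans (ENNReal.ofReal_le_ofReal ?_)
      rw [norm_exp_neg_mul_ofReal]
      have hs : 0 < t ^ (1 / m) := Real.rpow_pos_of_pos ht _
      have hY := rpow_mul_le_add_rpow hm hρ.le ht'.le (div_nonneg hd hs.le)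
      rw [mul_div_cancel₀ d hs.ne'] at hY
      set v := (d / t ^ (1 / m)) ^ (m / (m - 1))
      have hv : 0 ≤ v := Real.rpow_nonneg (div_nonneg hd hs.le) _
      have hexp : Real.exp (-(z.re * t)) * Real.exp (-(b / 2 * v)) ≤
          Real.exp (-(β * (ρ ^ (1 / m) * d))) * Real.exp (-(ρ * c / 2 * t)) := by
        rw [← Real.exp_add, ← Real.exp_add]
        refine Real.exp_le_exp.2 ?_
        have h1 : ρ * c * t ≤ z.re * t := by gcongr
        have h2 : β * (ρ ^ (1 / m) * d) ≤ β * (ρ * t + v) := by gcongr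
        have h3 : β * (ρ * t) ≤ c / 2 * (ρ * t) := by gcongr; exact min_le_left _ _
        have h4 : β * v ≤ b / 2 * v := by gcongr; exact min_le_right _ _
        linarith
      calc _ = C₁ * t ^ (-α) * (Real.exp (-(z.re * t)) * Real.exp (-(b / 2 * v))) := by ring
        _ ≤ C₁ * t ^ (-α) *
            (Real.exp (-(β * (ρ ^ (1 / m) * d))) * Real.exp (-(ρ * c / 2 * t))) := by gcongr
        _ = φ t := by
          simp only [φ, K]
          rw [show (1 - α) - 1 = -α by ring]
          ring
  refine (twoBallNorm_smul_le_ofReal z hmain).trans (ENNReal.ofReal_le_ofReal ?_)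
  have hint : ∫ t in Ioi (0 : ℝ), φ t =
      K * ((1 / (ρ * c / 2)) ^ (1 - α) * Real.Gamma (1 - α)) := by
    rw [← hval]; exact integral_const_mul _ _
  have hpow : ρ * (1 / (ρ * c / 2)) ^ (1 - α) = (2 / c) ^ (1 - α) * ρ ^ α := by
    rw [show 1 / (ρ * c / 2) = (2 / c) * ρ⁻¹ by field_simp,
      Real.mul_rpow (by positivity) (by positivity), Real.inv_rpow hρ.le,
      Real.rpow_sub hρ, Real.rpow_one]
    field_simp
  -- Here `ρ^{1/m} r = 1`, so the loss of `2r` in the distance costs only the factor `e^{2β}`.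
  have hdist : ρ ^ (1 / m) * ‖x - y‖ ≤ ρ ^ (1 / m) * d + 2 := by
    have h1 : ‖x - y‖ - 2 * r ≤ d := le_max_left _ _
    have h2 : ρ ^ (1 / m) * r = 1 := by rw [hr', ← Real.rpow_add hρ]; simp
    have h3 : 0 < ρ ^ (1 / m) := Real.rpow_pos_of_pos hρ _
    nlinarith
  have hexp : Real.exp (-(β * (ρ ^ (1 / m) * d))) ≤
      Real.exp (2 * β) * Real.exp (-(β * ρ ^ (1 / m) * ‖x - y‖)) := by
    rw [← Real.exp_add]
    refine Real.exp_le_exp.2 ?_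
    nlinarith
  rw [hint]
  calc _ = C₁ * Real.exp (-(β * (ρ ^ (1 / m) * d))) *
        (ρ * (1 / (ρ * c / 2)) ^ (1 - α)) * Real.Gamma (1 - α) := by ring
    _ ≤ C₁ * (Real.exp (2 * β) * Real.exp (-(β * ρ ^ (1 / m) * ‖x - y‖))) *
        (ρ * (1 / (ρ * c / 2)) ^ (1 - α)) * Real.Gamma (1 - α) := by gcongr
    _ = _ := by rw [hpow]; ring

end SemigroupToResolvent

/-! ### From resolvent bounds to semigroup bounds. -/

section ResolventToSemigroup

theorem abs_arg_lt_of_neg_lt_re {z : ℂ} {θ : ℝ} (hθ : θ ∈ Ioo 0 (Real.pi / 2))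
    (h : -(‖z‖ * Real.cos θ) < z.re) : |z.arg| < Real.pi - θ := by
  by_contra! hz
  have h1 := Real.cos_le_cos_of_nonneg_of_le_pi (by linarith [hθ.2, Real.pi_pos])
    (Complex.abs_arg_le_pi z) hz
  rw [Real.cos_abs, Real.cos_pi_sub] at h1
  rw [← Complex.norm_mul_cos_arg z] at h
  nlinarith [norm_nonneg z]

/-- As `Re w > 0`, moving by `(cos θ / 4)‖w‖` keeps `Re z > -(cos θ / 4)‖w‖`, while `‖z‖ ≥
(3/4)‖w‖`; hence `Re z > -‖z‖ cos θ`. -/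
theorem abs_arg_lt_of_mem_closedBall {w z : ℂ} {θ : ℝ} (hθ : θ ∈ Ioo 0 (Real.pi / 2))
    (hw : 0 < w.re) (hz : z ∈ Metric.closedBall w (Real.cos θ / 4 * ‖w‖)) :
    ‖w‖ / 2 ≤ ‖z‖ ∧ |z.arg| < Real.pi - θ := by
  have hc : 0 < Real.cos θ := Real.cos_pos_of_mem_Ioo ⟨by linarith [hθ.1, Real.pi_pos], hθ.2⟩
  have hc1 : Real.cos θ ≤ 1 := Real.cos_le_one θ
  have hw0 : 0 < ‖w‖ := norm_pos_iff.2 fun h => by simp [h] at hw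
  rw [Metric.mem_closedBall, dist_eq_norm] at hz
  have h1 : ‖w‖ ≤ ‖z‖ + ‖z - w‖ := by
    have := norm_sub_le z (z - w)
    rwa [sub_sub_cancel] at this
  have h2 : 3 / 4 * ‖w‖ ≤ ‖z‖ := by nlinarith
  refine ⟨by linarith, abs_arg_lt_of_neg_lt_re hθ ?_⟩
  have h3 := (Complex.abs_re_le_norm (z - w)).trans hz
  rw [Complex.sub_re] at h3
  have h4 := (abs_le.1 h3).1
  nlinarith

theorem mem_slitPlane_of_abs_arg_lt {z : ℂ} {φ : ℝ} (hφ : φ ≤ Real.pi) (hz0 : z ≠ 0)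
    (hz : |z.arg| < φ) : z ∈ Complex.slitPlane := by
  rw [Complex.mem_slitPlane_iff_arg]
  refine ⟨fun h => ?_, hz0⟩
  rw [h, abs_of_pos Real.pi_pos] at hz
  linarith

variable {D n : ℕ} {Ω : Set (EuclideanSpace ℝ (Fin D))} {p q : ℝ≥0∞}

/-- Two-ball bounds for `(z + L)⁻¹` on balls of a radius that is unrelated to `z`. -/
theorem twoBallNorm_shiftInv_le_of_radius (hΩ : MeasurableSet Ω) (hp : 1 ≤ p) (hp' : p ≠ ∞)
    (hpq : p ≤ q) {L : LTwo Ω n →ₗ.[ℂ] LTwo Ω n} {m α b C : ℝ} (hb : 0 < b) (hC : 0 < C)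
    {z : ℂ} (hz : z ≠ 0)
    (h : ∀ x ∈ Ω, ∀ y ∈ Ω, twoBallNorm p q (z • shiftInv L z) x y (‖z‖ ^ (-(1 / m))) ≤
      ENNReal.ofReal (C * ‖z‖ ^ α * Real.exp (-(b * ‖z‖ ^ (1 / m) * ‖x - y‖))))
    (r : ℝ) (x y : EuclideanSpace ℝ (Fin D)) :
    twoBallNorm p q (shiftInv L z) x y r ≤
      ENNReal.ofReal (gridConst D (b / 2) * C * ‖z‖ ^ (α - 1) *
        Real.exp (-(b / 2 * (‖z‖ ^ (1 / m) * max (‖x - y‖ - 2 * r) 0)))) := by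
  set ρ := ‖z‖
  have hρ : 0 < ρ := norm_pos_iff.2 hz
  set d := max (‖x - y‖ - 2 * r) 0
  have hs : 0 < ρ ^ (-(1 / m)) := Real.rpow_pos_of_pos hρ _
  have hA : 0 ≤ C * ρ ^ (α - 1) * Real.exp (-(b / 2 * (ρ ^ (1 / m) * d))) := by positivity
  refine (twoBallNorm_le_of_small_scale hΩ hp hp' hpq hs hA (half_pos hb) ?_).trans ?_
  · intro x' hx' y' hy'
    have h1 := twoBallNorm_smul_le_ofReal z⁻¹ (h x' hx'.1 y' hy'.1)
    rw [smul_smul, inv_mul_cancel₀ hz, one_smul, norm_inv] at h1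
    refine h1.trans (ENNReal.ofReal_le_ofReal ?_)
    have hdist := max_norm_sub_le_of_mem_ball hx'.2 hy'.2
    have hdiv : ‖x' - y'‖ / ρ ^ (-(1 / m)) = ρ ^ (1 / m) * ‖x' - y'‖ := by
      rw [Real.rpow_neg hρ.le, div_inv_eq_mul, mul_comm]
    rw [hdiv, mul_assoc (C * _), ← Real.exp_add, Real.rpow_sub_one hρ.ne']
    have hexp : -(b * ρ ^ (1 / m) * ‖x' - y'‖) ≤
        -(b / 2 * (ρ ^ (1 / m) * d)) + -(b / 2 * (ρ ^ (1 / m) * ‖x' - y'‖)) := by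
      have : b / 2 * (ρ ^ (1 / m) * d) ≤ b / 2 * (ρ ^ (1 / m) * ‖x' - y'‖) := by gcongr
      linarith
    calc _ = C * (ρ ^ α / ρ) * Real.exp (-(b * ρ ^ (1 / m) * ‖x' - y'‖)) := by
          change ρ⁻¹ * _ = _
          ring
      _ ≤ _ := by gcongr
  · refine ENNReal.ofReal_le_ofReal (le_of_eq ?_)
    ring

/-- Two `L^p → L^q` bounds cannot be composed directly, but Cauchy's formula is linear in the
resolvent. Its radius, comparable to `‖w‖`, yields the extra factor `‖w‖⁻¹`. On the circle `‖z‖ ≥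
‖w‖/2`, which accounts for `2^{1-α}` and for the passage from `b/2` to `b/4`. -/
theorem twoBallNorm_shiftInv_sq_le (hΩ : MeasurableSet Ω)
    {L : LTwo Ω n →ₗ.[ℂ] LTwo Ω n} (hL : IsSelfAdjoint L) (hL0 : NonNegative L)
    (hp : 1 ≤ p) (hp' : p ≠ ∞) (hpq : p ≤ q) {m α b C θ : ℝ} (hm : 2 ≤ m) (hα : α < 1)
    (hb : 0 < b) (hC : 0 < C) (hθ : θ ∈ Ioo 0 (Real.pi / 2))
    (h : ∀ x ∈ Ω, ∀ y ∈ Ω, ∀ z : ℂ, z ≠ 0 → |z.arg| < Real.pi - θ →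
      twoBallNorm p q (z • shiftInv L z) x y (‖z‖ ^ (-(1 / m))) ≤
      ENNReal.ofReal (C * ‖z‖ ^ α * Real.exp (-(b * ‖z‖ ^ (1 / m) * ‖x - y‖))))
    (r : ℝ) (x y : EuclideanSpace ℝ (Fin D)) {w : ℂ} (hw : 0 < w.re) :
    twoBallNorm p q (shiftInv L w * shiftInv L w) x y r ≤
      ENNReal.ofReal (gridConst D (b / 2) * C * 2 ^ (1 - α) / (Real.cos θ / 4) *
        ‖w‖ ^ (α - 2) *
        Real.exp (-(b / 4 * (‖w‖ ^ (1 / m) * max (‖x - y‖ - 2 * r) 0)))) := by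
  have hc : 0 < Real.cos θ := Real.cos_pos_of_mem_Ioo ⟨by linarith [hθ.1, Real.pi_pos], hθ.2⟩
  have hw0 : 0 < ‖w‖ := norm_pos_iff.2 fun h => by simp [h] at hw
  set ρ := ‖w‖
  set d := max (‖x - y‖ - 2 * r) 0
  have hd : 0 ≤ d := le_max_right _ _
  set G := gridConst D (b / 2)
  have hG : 0 < G := gridConst_pos D (half_pos hb)
  set δ := Real.cos θ / 4 * ρ with hδ
  have hδ0 : 0 < δ := by positivity
  have hball : ∀ z ∈ Metric.closedBall w δ, z ≠ 0 ∧ |z.arg| < Real.pi - θ ∧ ρ / 2 ≤ ‖z‖ := by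
    intro z hz
    obtain ⟨h1, h2⟩ := abs_arg_lt_of_mem_closedBall hθ hw hz
    exact ⟨norm_pos_iff.1 ((half_pos hw0).trans_le h1), h2, h1⟩
  have hslit : Metric.closedBall w δ ⊆ Complex.slitPlane := fun z hz =>
    mem_slitPlane_of_abs_arg_lt (by linarith [hθ.1]) (hball z hz).1 (hball z hz).2.1
  have hcirc : ∀ φ : ℝ, circleMap w δ φ ∈ Metric.closedBall w δ := fun φ =>
    circleMap_mem_closedBall w hδ0.le φ
  set M : ℝ := G * C * (2 ^ (1 - α) * ρ ^ (α - 1)) * Real.exp (-(b / 4 * (ρ ^ (1 / m) * d)))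
  have hM : 0 < M := by positivity
  have hR : ∀ z ∈ Metric.closedBall w δ,
      twoBallNorm p q (shiftInv L z) x y r ≤ ENNReal.ofReal M := by
    intro z hz
    obtain ⟨hz0, hz1, hz2⟩ := hball z hz
    refine (twoBallNorm_shiftInv_le_of_radius hΩ hp hp' hpq hb hC hz0
      (fun x hx y hy => h x hx y hy z hz0 hz1) r x y).trans (ENNReal.ofReal_le_ofReal ?_)
    have h1 : ‖z‖ ^ (α - 1) ≤ 2 ^ (1 - α) * ρ ^ (α - 1) := by
      calc ‖z‖ ^ (α - 1) ≤ (ρ / 2) ^ (α - 1) :=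
            Real.rpow_le_rpow_of_nonpos (half_pos hw0) hz2 (by linarith)
        _ = _ := by
          rw [Real.div_rpow hw0.le zero_le_two, div_eq_mul_inv, ← Real.rpow_neg zero_le_two,
            neg_sub, mul_comm]
    have h2 : ρ ^ (1 / m) / 2 ≤ ‖z‖ ^ (1 / m) := by
      have hm0 : 0 < m := by linarith
      have h3 : (2 : ℝ) ^ (1 / m) ≤ 2 := by
        calc (2 : ℝ) ^ (1 / m) ≤ 2 ^ (1 : ℝ) :=
              Real.rpow_le_rpow_of_exponent_le one_le_two (by
                rw [div_le_one hm0]; linarith)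
          _ = 2 := Real.rpow_one 2
      calc ρ ^ (1 / m) / 2 ≤ ρ ^ (1 / m) / 2 ^ (1 / m) := by gcongr
        _ = (ρ / 2) ^ (1 / m) := (Real.div_rpow hw0.le zero_le_two _).symm
        _ ≤ _ := by gcongr
    have h4 : b / 4 * (ρ ^ (1 / m) * d) ≤ b / 2 * (‖z‖ ^ (1 / m) * d) := by
      calc _ = b / 2 * (ρ ^ (1 / m) / 2 * d) := by ring
        _ ≤ _ := by gcongr
    calc _ ≤ G * C * (2 ^ (1 - α) * ρ ^ (α - 1)) *
          Real.exp (-(b / 2 * (‖z‖ ^ (1 / m) * d))) := by gcongr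
      _ ≤ G * C * (2 ^ (1 - α) * ρ ^ (α - 1)) *
          Real.exp (-(b / 4 * (ρ ^ (1 / m) * d))) := by gcongr
  have hmain := twoBallNorm_le_integral (p := p) (q := q) (x := x) (y := y) (r := r)
    (ν := volume.restrict (Ioc 0 (2 * Real.pi))) (hp.trans hpq)
    (T := shiftInv L w * shiftInv L w)
    (F := fun φ : ℝ => (-((2 * Real.pi * δ : ℝ) : ℂ)⁻¹ * Complex.exp (-(φ * Complex.I))) •
        shiftInv L (circleMap w δ φ)) (φ := fun _ => (2 * Real.pi * δ)⁻¹ * M)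
    (integrable_const _) (Eventually.of_forall fun _ => by positivity) ?_
    (fun f => shiftInv_sq_eq_integral hL hL0 hδ0 hslit f) (Eventually.of_forall fun φ => ?_)
  · refine hmain.trans (ENNReal.ofReal_le_ofReal (le_of_eq ?_))
    rw [setIntegral_const, Real.volume_real_Ioc_of_le Real.two_pi_pos.le, sub_zero, smul_eq_mul]
    simp only [M, hδ]
    rw [show α - 1 = (α - 2) + 1 by ring, Real.rpow_add_one hw0.ne']
    field_simp
  · intro f
    have hcont : Continuous fun φ : ℝ => shiftInv L (circleMap w δ φ) := by
      rw [continuous_iff_continuousAt]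
      exact fun φ => ContinuousAt.comp (continuousAt_shiftInv hL hL0 (hslit (hcirc φ)))
        (continuous_circleMap w δ).continuousAt
    refine Continuous.integrableOn_Ioc ?_
    have hexp : Continuous fun φ : ℝ =>
        -((2 * Real.pi * δ : ℝ) : ℂ)⁻¹ * Complex.exp (-(φ * Complex.I)) := by fun_prop
    exact hexp.smul (hcont.clm_apply continuous_const)
  · refine (twoBallNorm_smul_le_ofReal _ (hR _ (hcirc φ))).trans (ENNReal.ofReal_le_ofReal ?_)
    rw [norm_mul, norm_neg, norm_inv, Complex.norm_real, Complex.norm_exp,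
      Real.norm_of_nonneg (by positivity)]
    simp

theorem norm_linePoint_rpow {R : ℝ} (hR : 0 < R) (ξ a : ℝ) :
    ‖linePoint R ξ‖ ^ a = R ^ a * (1 + ‖2 * Real.pi / R * ξ‖ ^ 2) ^ (a / 2) := by
  have h1 : ‖linePoint R ξ‖ ^ 2 = R ^ 2 * (1 + ‖2 * Real.pi / R * ξ‖ ^ 2) := by
    rw [Complex.sq_norm, Complex.normSq_apply, linePoint_re, linePoint_im, Real.norm_eq_abs, sq_abs]
    field_simp
  have h2 : ∀ u : ℝ, 0 ≤ u → u ^ a = (u ^ 2) ^ (a / 2) := fun u hu => by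
    rw [← Real.rpow_natCast u 2, ← Real.rpow_mul hu]
    congr 1
    push_cast
    ring
  rw [h2 _ (norm_nonneg _), h1, Real.mul_rpow (by positivity) (by positivity), ← h2 R hR.le]

/-- On the line `Re w = R` the exponential factor is at most its value for `‖w‖ = R`, the power of
`‖w‖` is integrated after scaling `ξ` by `2π/R`, and `e^{Rt}` comes from undoing the weight. `R`
stays free for optimisation. -/
theorem twoBallNorm_semigroup_le_of_line
    {L : LTwo Ω n →ₗ.[ℂ] LTwo Ω n} (hL : IsSelfAdjoint L) (hL0 : NonNegative L)
    (hq : 1 ≤ q) {m α b K : ℝ} (hm : 2 ≤ m) (hα : α < 1) (hb : 0 < b) (hK : 0 < K)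
    {r : ℝ} {x y : EuclideanSpace ℝ (Fin D)} {d : ℝ} (hd : 0 ≤ d)
    (h : ∀ w : ℂ, 0 < w.re → twoBallNorm p q (shiftInv L w * shiftInv L w) x y r ≤
      ENNReal.ofReal (K * ‖w‖ ^ (α - 2) * Real.exp (-(b * (‖w‖ ^ (1 / m) * d)))))
    {R t : ℝ} (hR : 0 < R) (ht : 0 < t) :
    twoBallNorm p q (semigroup L t) x y r ≤
      ENNReal.ofReal (K / (2 * Real.pi) * (∫ v : ℝ, (1 + ‖v‖ ^ 2) ^ (-(2 - α) / 2)) * t⁻¹ *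
        R ^ (α - 1) * Real.exp (R * t - b * (R ^ (1 / m) * d))) := by
  set J : ℝ → ℝ := fun v => (1 + ‖v‖ ^ 2) ^ (-(2 - α) / 2) with hJ
  -- Here `α < 1` enters: the decay exponent `2 - α` must exceed the dimension `1` of the line.
  have hJi : Integrable J := integrable_rpow_neg_one_add_norm_sq (by simp; linarith)
  have hJpos : ∀ v, 0 < J v := fun v => Real.rpow_pos_of_pos (by positivity) _
  have ha : 2 * Real.pi / R ≠ 0 := by positivity
  set N : ℝ := t⁻¹ * K * R ^ (α - 2) * Real.exp (R * t - b * (R ^ (1 / m) * d))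
  have hN : 0 < N := by positivity
  have hmain := twoBallNorm_le_integral (p := p) (q := q) (x := x) (y := y) (r := r)
    (ν := volume) hq (T := semigroup L t)
    (F := fun ξ : ℝ => (((t * Real.exp (-(R * t)))⁻¹ : ℝ) *
      Complex.exp ((2 * Real.pi * (ξ * t) : ℝ) * Complex.I)) •
        (shiftInv L (linePoint R ξ) * shiftInv L (linePoint R ξ)))
    (φ := fun ξ => N * J (2 * Real.pi / R * ξ))
    ((hJi.comp_mul_left' ha).const_mul N)
    (Eventually.of_forall fun ξ => mul_pos hN (hJpos _)) ?_ ?_ (Eventually.of_forall fun ξ => ?_)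
  · refine hmain.trans (ENNReal.ofReal_le_ofReal (le_of_eq ?_))
    rw [integral_const_mul, Measure.integral_comp_mul_left, abs_of_pos (by positivity),
      smul_eq_mul]
    simp only [N]
    rw [show α - 1 = (α - 2) + 1 by ring, Real.rpow_add_one hR.ne']
    field_simp
  · intro f
    simp only [mul_smul, smul_apply]
    refine Integrable.smul (((t * Real.exp (-(R * t)))⁻¹ : ℝ) : ℂ) ?_
    refine (integrable_shiftInv_sq_linePoint hL hL0 f hR).bdd_smul (𝕜 := ℂ) (C := 1) ?_ ?_
    · exact Continuous.aestronglyMeasurable (by fun_prop)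
    · refine Eventually.of_forall fun ξ => ?_
      rw [Complex.norm_exp_ofReal_mul_I]
  · intro f
    have h1 := smul_semigroup_eq_integral hL hL0 f hR ht
    simp only [mul_smul, smul_apply]
    rw [integral_smul]
    refine Eq.trans ?_ (congrArg (fun u : LTwo Ω n =>
      (((t * Real.exp (-(R * t)))⁻¹ : ℝ) : ℂ) • u) h1)
    have hne : ((t * Real.exp (-(R * t)) : ℝ) : ℂ) ≠ 0 :=
      Complex.ofReal_ne_zero.2 (by positivity)
    simp only [smul_smul]
    rw [Complex.ofReal_inv, inv_mul_cancel₀ hne, one_smul]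
  · have hre : 0 < (linePoint R ξ).re := by rwa [linePoint_re]
    refine (twoBallNorm_smul_le_ofReal _ (h _ hre)).trans (ENNReal.ofReal_le_ofReal ?_)
    have hRle : R ≤ ‖linePoint R ξ‖ := by
      have := Complex.re_le_norm (linePoint R ξ)
      rwa [linePoint_re] at this
    have hm0 : 0 ≤ 1 / m := by positivity
    rw [norm_mul, Complex.norm_exp_ofReal_mul_I, mul_one, Complex.norm_real,
      Real.norm_of_nonneg (by positivity), norm_linePoint_rpow hR ξ (α - 2), mul_inv,
      Real.exp_neg (R * t), inv_inv]
    calc _ ≤ t⁻¹ * Real.exp (R * t) * (K * (R ^ (α - 2) *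
          (1 + ‖2 * Real.pi / R * ξ‖ ^ 2) ^ ((α - 2) / 2)) *
          Real.exp (-(b * (R ^ (1 / m) * d)))) := by gcongr
      _ = N * J (2 * Real.pi / R * ξ) := by
        simp only [N, J]
        rw [sub_eq_add_neg (R * t), Real.exp_add, neg_sub]
        ring

theorem semigroupBounds_of_resolventBounds (hΩ : MeasurableSet Ω)
    {L : LTwo Ω n →ₗ.[ℂ] LTwo Ω n} (hL : IsSelfAdjoint L) (hL0 : NonNegative L)
    (hp : 1 ≤ p) (hp' : p ≠ ∞) (hpq : p ≤ q) {m : ℝ} (hm : 2 ≤ m)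
    (hD : smoothingExp D m p q < 1) {θ : ℝ} (hθ : θ ∈ Ioo 0 (Real.pi / 2))
    (h : ResolventBounds L m p q (Real.pi - θ)) : SemigroupBounds L m p q := by
  obtain ⟨b, C, hb, hC, h⟩ := h
  set α := smoothingExp D m p q
  have hc : 0 < Real.cos θ := Real.cos_pos_of_mem_Ioo ⟨by linarith [hθ.1, Real.pi_pos], hθ.2⟩
  set K := gridConst D (b / 2) * C * 2 ^ (1 - α) / (Real.cos θ / 4)
  have hG : 0 < gridConst D (b / 2) := gridConst_pos D (half_pos hb)
  have hK : 0 < K := by positivity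
  set I := ∫ v : ℝ, (1 + ‖v‖ ^ 2) ^ (-(2 - α) / 2)
  have hI : 0 ≤ I := integral_nonneg fun v => Real.rpow_nonneg (by positivity) _
  set μ := m / (m - 1) with hμdef
  have hm1 : 0 < m - 1 := by linarith
  have hμ : 1 ≤ μ := one_le_conjExponent hm
  have hμ2 : μ ≤ 2 := by rw [hμdef, div_le_iff₀ hm1]; linarith
  -- With `b/4 = 2ε` the gain in the exponent is at least twice `(εv)^μ`, so one copy survives the
  -- cost `Rt = 1 + (εv)^μ`.
  set ε := b / 8 with hε
  have hε0 : 0 < ε := by positivity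
  have hεμ : 0 < ε ^ μ := Real.rpow_pos_of_pos hε0 _
  -- `I + 1` makes the constant visibly positive with only `0 ≤ I` known; `e^{4ε^μ}` pays for the
  -- additive `16` in `hdist` below.
  refine ⟨ε ^ μ / 4, K / (2 * Real.pi) * (I + 1) * Real.exp (1 + 4 * ε ^ μ), by positivity,
    by positivity, fun t ht x _ y _ => ?_⟩
  set r := t ^ (1 / m)
  have hr : 0 < r := Real.rpow_pos_of_pos ht _
  set d := max (‖x - y‖ - 2 * r) 0
  have hd : 0 ≤ d := le_max_right _ _
  set v := d / r with hv'
  have hv : 0 ≤ v := div_nonneg hd hr.le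
  -- The abscissa is `R = σ/t`. The term `(εv)^μ` is the optimal order, since `μ/m = μ - 1`; the
  -- summand `1` keeps `R ≥ 1/t`, so that `R^{α-1} ≤ t^{1-α}` also for `v` near `0`.
  set σ := 1 + (ε * v) ^ μ
  have hεv : 0 ≤ (ε * v) ^ μ := Real.rpow_nonneg (by positivity) _
  have hσ : 1 ≤ σ := by linarith
  have hR : 0 < σ / t := by positivity
  refine (twoBallNorm_semigroup_le_of_line hL hL0 (hp.trans hpq) hm hD
    (show 0 < b / 4 by positivity) hK hd
    (fun w hw => twoBallNorm_shiftInv_sq_le hΩ hL hL0 hp hp' hpq hm hD hb hC hθ h r x y hw)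
    hR ht).trans (ENNReal.ofReal_le_ofReal ?_)
  have hRα : t⁻¹ * (σ / t) ^ (α - 1) ≤ t ^ (-α) := by
    have h1 : (σ / t) ^ (α - 1) ≤ t⁻¹ ^ (α - 1) := by
      refine Real.rpow_le_rpow_of_nonpos (by positivity) ?_ (by linarith)
      rw [inv_eq_one_div]
      gcongr
    calc t⁻¹ * (σ / t) ^ (α - 1) ≤ t⁻¹ * t⁻¹ ^ (α - 1) := by gcongr
      _ = t ^ (-α) := by
        rw [Real.inv_rpow ht.le, ← Real.rpow_neg ht.le, ← Real.rpow_neg_one t, ← Real.rpow_add ht]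
        congr 1
        ring
  have hexp1 : σ / t * t - b / 4 * ((σ / t) ^ (1 / m) * d) ≤ 1 - (ε * v) ^ μ := by
    have h1 : (σ / t) ^ (1 / m) * d = σ ^ (1 / m) * v := by
      rw [Real.div_rpow (by linarith) ht.le, hv', div_mul_eq_mul_div, mul_div_assoc]
    have h2 : (ε * v) ^ (μ - 1) ≤ σ ^ (1 / m) := by
      have h3 : μ - 1 = μ * (1 / m) := by
        rw [hμdef]
        have : m ≠ 0 := by linarith
        field_simp
        ring
      rw [h3, Real.rpow_mul (by positivity)]
      have : 0 ≤ 1 / m := by positivity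
      gcongr
      linarith
    have h4 : (ε * v) ^ μ ≤ σ ^ (1 / m) * (ε * v) := by
      rcases hv.eq_or_lt with h0 | h0
      · rw [← h0, mul_zero, Real.zero_rpow (by linarith), mul_zero]
      · calc (ε * v) ^ μ = (ε * v) ^ (μ - 1) * (ε * v) := by
              rw [← Real.rpow_add_one (by positivity), sub_add_cancel]
          _ ≤ _ := by gcongr
    rw [h1, div_mul_cancel₀ _ ht.ne']
    have h5 : b / 4 * (σ ^ (1 / m) * v) = 2 * (σ ^ (1 / m) * (ε * v)) := by rw [hε]; ring
    linarith
  -- Returns from `v` to the full distance. As `m ≥ 2` gives `μ ≤ 2`, the constants are `4^μ ≤ 16`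
  -- for `v ≤ 2` and `2^μ ≤ 4` for `v ≥ 2`.
  have hdist : (‖x - y‖ / r) ^ μ ≤ 4 * v ^ μ + 16 := by
    have h1 : ‖x - y‖ / r ≤ v + 2 := by
      rw [div_le_iff₀ hr, add_mul, hv', div_mul_cancel₀ _ hr.ne']
      linarith [le_max_left (‖x - y‖ - 2 * r) 0]
    have h2 : (‖x - y‖ / r) ^ μ ≤ (v + 2) ^ μ := by gcongr
    refine h2.trans ?_
    have hvμ : 0 ≤ v ^ μ := Real.rpow_nonneg hv _
    rcases le_total v 2 with h3 | h3
    · calc (v + 2) ^ μ ≤ 4 ^ μ := by gcongr; linarith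
        _ ≤ 4 ^ (2 : ℝ) := Real.rpow_le_rpow_of_exponent_le (by norm_num) hμ2
        _ = 16 := by norm_num
        _ ≤ _ := by linarith
    · calc (v + 2) ^ μ ≤ (2 * v) ^ μ := by gcongr; linarith
        _ = 2 ^ μ * v ^ μ := Real.mul_rpow zero_le_two hv
        _ ≤ 2 ^ (2 : ℝ) * v ^ μ := by
          gcongr
          exact one_le_two
        _ = 4 * v ^ μ := by norm_num
        _ ≤ _ := by linarith
  have hexp2 : σ / t * t - b / 4 * ((σ / t) ^ (1 / m) * d) ≤
      (1 + 4 * ε ^ μ) + -(ε ^ μ / 4 * (‖x - y‖ / r) ^ μ) := by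
    rw [Real.mul_rpow hε0.le hv] at hexp1
    nlinarith
  calc _ = K / (2 * Real.pi) * I * (t⁻¹ * (σ / t) ^ (α - 1)) *
        Real.exp (σ / t * t - b / 4 * ((σ / t) ^ (1 / m) * d)) := by ring
    _ ≤ K / (2 * Real.pi) * (I + 1) * t ^ (-α) *
        Real.exp ((1 + 4 * ε ^ μ) + -(ε ^ μ / 4 * (‖x - y‖ / r) ^ μ)) := by
        gcongr
        linarith
    _ = _ := by rw [Real.exp_add]; ring

end ResolventToSemigroup

end TwoBall

theorem mainTheorem6 {D n : ℕ} (Ω : Set (EuclideanSpace ℝ (Fin D))) (hΩ : MeasurableSet Ω)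
    (L : TwoBall.LTwo Ω n →ₗ.[ℂ] TwoBall.LTwo Ω n) (hL : IsSelfAdjoint L)
    (hL0 : TwoBall.NonNegative L) (p q : ℝ≥0∞) (hp1 : 1 ≤ p) (hp2 : p ≤ 2) (hq : 2 ≤ q)
    (m : ℝ) (hm : 2 ≤ m) (hD : (D : ℝ) / m * ((1 / p).toReal - (1 / q).toReal) < 1) :
    (∀ θ ∈ Set.Ioo (0 : ℝ) (Real.pi / 2),
      TwoBall.ResolventBounds L m p q (Real.pi - θ) → TwoBall.SemigroupBounds L m p q) ∧
    (TwoBall.SemigroupBounds L m p q →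
      ∀ θ ∈ Set.Ioo (0 : ℝ) (Real.pi / 2), TwoBall.ResolventBounds L m p q θ) := by
  have hp' : p ≠ ∞ := (hp2.trans_lt ENNReal.ofNat_lt_top).ne
  exact ⟨fun θ hθ h => TwoBall.semigroupBounds_of_resolventBounds hΩ hL hL0 hp1 hp' (hp2.trans hq)
      hm hD hθ h,
    fun h θ hθ => TwoBall.resolventBounds_of_semigroupBounds hΩ hL hL0 hp1 hp' (hp2.trans hq)
      hm hD h hθ⟩
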